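/- **Setting.** For $n\ge 1$ let $S(2n)$ be the group of permutations of $\{-n,\dots,-1,1,\dots,n\}$, $H(n)\subset S(2n)$ the centralizer of $\breve t=(-n\,n)\cdots(-1\,1)$, and $S(2\infty)=\bigcup_n S(2n)$. Let $X(n)=H(n)\backslash S(2n)$, realized as the set of partitions of $\{-n,\dots,-1,1,\dots,n\}$ into $n$ unordered pairs, with the right action of $g\in S(2n)$ that replaces each pair $\{i,j\}$ by $\{g(i),g(j)\}$ (permutations being multiplied from left to right). For $x\in X(n)$ let $[x]_n$ be the number of cycles of $x$, i.e. of classes of the equivalence relation on $\{-n,\dots,-1,1,\dots,n\}$ generated by $i\sim -i$ and $i\sim j$ for $\{i,j\}\in x$. Let $p_{n,n+1}:X(n+1)\to X(n)$ delete the pair $\{n+1,-n-1\}$ if it is present and otherwise replace $\{i,-n-1\},\{k,n+1\}$ by $\{i,k\}$; let $X=\varprojlim X(n)$, with projections $p_n:X\to X(n)$. The group $S(2\infty)$ acts on $X$ from the right by $p_n(x\cdot g)=p_n(x)\cdot g$ for $n$ large, and $c(x;g)=[p_n(x)\cdot g]_n-[p_n(x)]_n$ does not depend on $n$ when $g\in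 S(2n)$. For $t>0$ let $\mu_t$ be the probability measure on $X$ with $\mu_t(p_n^{-1}(x))=\dfrac{t^{[x]_n}}{t(t+2)\cdots(t+2n-2)}$ for all $n$ and $x\in X(n)$. For $z\in\mathbb C\setminus\{0\}$ and $t=|z|^2$ let $T_{z,1/2}$ be the unitary representation of $S(2\infty)$ in $L^2(X,\mu_t)$ given by $(T_{z,1/2}(g)f)(x)=z^{c(x;g)}f(x\cdot g)$, and let $$\varphi_z(g)=\bigl(T_{z,1/2}(g)\mathbf 1,\mathbf 1\bigr)_{L^2(X,\mu_t)},\qquad g\in S(2\infty),$$ be its spherical function, the matrix coefficient of the constant function $\mathbf 1$ (a unit vector invariant under $\bigcup_n H(n)$). For a Young diagram $\lambda$ with $n$ boxes let $\chi^{2\lambda}$ be the irreducible character of $S(2n)$ labelled by $2\lambda=(2\lambda_1,2\lambda_2,\dots)$, $\dim 2\lambda=\chi^{2\lambda}(e)$, and let $$w^\lambda(g)=\frac1{|H(n)|}\sum_{h\in H(n)}\chi^{2\lambda}(gh),\qquad g\in S(2n),$$ be the zonal spherical function of $(S(2n),H(n))$, also viewed as a function on $X(n)=H(n)\backslash S(2n)$.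 Let $$F_z^{(n)}(x)=\left(\frac{1\cdot3\cdots(2n-1)}{t(t+2)\cdots(t+2n-2)}\right)^{1/2}z^{[x]_n}\quad(x\in X(n)),\qquad M^{(n)}_{z,1/2}(\lambda)=\left|\bigl(F_z^{(n)},(\dim 2\lambda)^{1/2}w^\lambda\bigr)\right|^2,$$ with the inner product $(f_1,f_2)=\frac1{|X(n)|}\sum_{x\in X(n)}f_1(x)\overline{f_2(x)}$. **Proposition and corollary.** For every nonzero $z\in\mathbb C$ and every $n$, $$\varphi_z(g)=\sum_{|\lambda|=n}M^{(n)}_{z,1/2}(\lambda)\,w^\lambda(g)\qquad\text{for all } g\in S(2n).$$ Moreover $M^{(n)}_{z,1/2}(\lambda)\ge0$ and $\sum_{|\lambda|=n}M^{(n)}_{z,1/2}(\lambda)=1$, so that $M^{(n)}_{z,1/2}$ is a probability measure on the set $\mathbb Y_n$ of Young diagrams with $n$ boxes. -/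

import Mathlib

open MeasureTheory Equiv

noncomputable section

namespace GelfandZ

/-- The `2n` symbols `-n, …, -1, 1, …, n`. -/
def letters (n : ℕ) : Finset ℤ := (Finset.Icc (-(n : ℤ)) n).erase 0

/-- The set `{-n, …, -1, 1, …, n}` as a type; the group `S(2n)` is `Perm (Letters n)`. -/
abbrev Letters (n : ℕ) : Type := {k : ℤ // k ∈ letters n}

theorem mem_letters {n : ℕ} {k : ℤ} : k ∈ letters n ↔ k ≠ 0 ∧ -(n : ℤ) ≤ k ∧ k ≤ n := by
  simp [letters]

theorem letters_mono {m n : ℕ} (h : m ≤ n) : letters m ⊆ letters n := by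
  intro k hk
  rw [mem_letters] at hk ⊢
  omega

theorem neg_mem_letters {n : ℕ} {k : ℤ} (h : k ∈ letters n) : -k ∈ letters n := by
  rw [mem_letters] at h ⊢
  omega

/-- The element `t̆ ∈ S(2n)`, the product of the transpositions `(-n, n), …, (-1, 1)`. -/
def flip (n : ℕ) : Perm (Letters n) where
  toFun i := ⟨-i.1, neg_mem_letters i.2⟩
  invFun i := ⟨-i.1, neg_mem_letters i.2⟩
  left_inv i := Subtype.ext (neg_neg i.1)
  right_inv i := Subtype.ext (neg_neg i.1)

theorem flip_flip {n : ℕ} (i : Letters n) : flip n (flip n i) = i := (flip n).left_inv i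

theorem flip_ne {n : ℕ} (i : Letters n) : flip n i ≠ i := by
  intro h
  have h1 : -i.1 = i.1 := congrArg Subtype.val h
  have h2 := (mem_letters.1 i.2).1
  omega

/-- The hyperoctahedral group `H(n)`, the centralizer of `t̆` in `S(2n)`. -/
def hyperoctahedral (n : ℕ) : Subgroup (Perm (Letters n)) := Subgroup.centralizer {flip n}

/-- An element of `X(n)`: a partition of `{-n, …, -1, 1, …, n}` into `n` unordered pairs
`{i, partner i}`. -/
@[ext] structure Pairing (n : ℕ) where
  partner : Letters n → Letters n
  partner_partner : ∀ i, partner (partner i) = i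
  partner_ne : ∀ i, partner i ≠ i

instance (n : ℕ) : Fintype (Pairing n) :=
  Fintype.ofInjective Pairing.partner fun _ _ h => Pairing.ext h

instance (n : ℕ) : MeasurableSpace (Pairing n) := ⊤

instance (n : ℕ) : DiscreteMeasurableSpace (Pairing n) := ⟨fun _ => trivial⟩

/-- A permutation `g` sends the pairing with the pairs `{i, j}` to the one with the pairs
`{g i, g j}`.  This is the right action `x ↦ x · g` of `S(2n)` for permutations multiplied from
left to right; with Lean's product of permutations it is a left action, written `g • x`. -/
instance (n : ℕ) : MulAction (Perm (Letters n)) (Pairing n) where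
  smul g x :=
    { partner := fun i => g (x.partner (g⁻¹ i))
      partner_partner := fun i => by simp [x.partner_partner]
      partner_ne := fun i h => x.partner_ne (g⁻¹ i) (by
        have := congrArg (g⁻¹ : Perm (Letters n)) h
        simpa using this) }
  one_smul _ := rfl
  mul_smul _ _ _ := rfl

theorem smul_partner {n : ℕ} (g : Perm (Letters n)) (x : Pairing n) (i : Letters n) :
    (g • x).partner i = g (x.partner (g⁻¹ i)) := rfl

theorem smul_partner' {n : ℕ} (g : Perm (Letters n)) (x : Pairing n) (i : Letters n) :
    (g • x).partner (g i) = g (x.partner i) := by simp [smul_partner]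

/-- The pairing `{{-n, n}, …, {-1, 1}}`; its stabilizer is `H(n)`, so `X(n) = H(n) \ S(2n)`. -/
def basePairing (n : ℕ) : Pairing n := ⟨flip n, flip_flip, flip_ne⟩

/-- The two kinds of steps `i → partner i` and `i → -i` along the cycles of a pairing. -/
def Pairing.step {n : ℕ} (x : Pairing n) (i j : Letters n) : Prop :=
  j = x.partner i ∨ j = flip n i

/-- The number `[x]ₙ` of cycles `j₁ → -j₂ → j₂ → -j₃ → ⋯ → -j₁ → j₁` of a pairing, i.e. of classes
of the equivalence relation generated by the steps. -/
def Pairing.circles {n : ℕ} (x : Pairing n) : ℕ := Nat.card (Quot x.step)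

/-! ### Deleting and inserting the symbols `±(n+1)` -/

/-- The inclusion of `{-n, …, n}` into `{-n-1, …, n+1}`. -/
def incl {n : ℕ} (i : Letters n) : Letters (n + 1) := ⟨i.1, letters_mono n.le_succ i.2⟩

/-- The symbol `n + 1`. -/
def top (n : ℕ) : Letters (n + 1) := ⟨(n : ℤ) + 1, by rw [mem_letters]; push_cast; omega⟩

theorem incl_injective {n : ℕ} : Function.Injective (incl : Letters n → Letters (n + 1)) :=
  fun _ _ h => Subtype.ext (Subtype.mk.inj h)

theorem incl_ne_top {n : ℕ} (i : Letters n) : incl i ≠ top n := by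
  intro h
  have h1 : i.1 = (n : ℤ) + 1 := congrArg Subtype.val h
  have h2 := mem_letters.1 i.2
  omega

theorem flip_incl {n : ℕ} (i : Letters n) : flip (n + 1) (incl i) = incl (flip n i) := rfl

theorem incl_ne_bot {n : ℕ} (i : Letters n) : incl i ≠ flip (n + 1) (top n) := by
  intro h
  apply incl_ne_top (flip n i)
  rw [← flip_incl, h, flip_flip]

theorem letters_cases {n : ℕ} (k : Letters (n + 1)) :
    (∃ i, k = incl i) ∨ k = top n ∨ k = flip (n + 1) (top n) := by
  by_cases h : k.1 ∈ letters n
  · exact Or.inl ⟨⟨k.1, h⟩, rfl⟩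
  · right
    have h1 := mem_letters.1 k.2
    rw [mem_letters] at h
    push_cast at h1
    by_cases h2 : k.1 = (n : ℤ) + 1
    · exact Or.inl (Subtype.ext h2)
    · refine Or.inr (Subtype.ext ?_)
      change k.1 = -((n : ℤ) + 1)
      omega

theorem not_mem_iff {n : ℕ} (k : Letters (n + 1)) :
    k.1 ∉ letters n ↔ k = top n ∨ k = flip (n + 1) (top n) := by
  constructor
  · intro h
    rcases letters_cases k with ⟨i, rfl⟩ | h'
    · exact absurd i.2 h
    · exact h'
  · rintro h hk
    rcases h with rfl | rfl
    · exact incl_ne_top ⟨_, hk⟩ rfl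
    · exact incl_ne_bot ⟨_, hk⟩ rfl

theorem proj_aux {n : ℕ} (x : Pairing (n + 1)) (i : Letters n)
    (h : (x.partner (incl i)).1 ∉ letters n) :
    (x.partner (flip (n + 1) (x.partner (incl i)))).1 ∈ letters n := by
  by_contra h'
  rw [not_mem_iff] at h h'
  have h1 := x.partner_partner (incl i)
  have h3 := x.partner_ne (top n)
  have h4 := x.partner_ne (flip (n + 1) (top n))
  have h5 := incl_ne_top i
  have h6 := incl_ne_bot i
  have h7 := x.partner_partner (top n)
  have h8 := x.partner_partner (flip (n + 1) (top n))
  rcases h with h | h <;> rw [h] at h' h1 <;> (try rw [flip_flip] at h') <;>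
    rcases h' with h' | h' <;> grind

/-- The partner of `i` in the derivative of a pairing `x`: the partner of `i` in `x`, except that
if this is `±(n+1)` one takes the partner of `∓(n+1)`. -/
def projFun {n : ℕ} (x : Pairing (n + 1)) (i : Letters n) : Letters n := by
  classical
  exact if h : (x.partner (incl i)).1 ∈ letters n then ⟨(x.partner (incl i)).1, h⟩
    else ⟨(x.partner (flip (n + 1) (x.partner (incl i)))).1, proj_aux x i h⟩

theorem projFun_in {n : ℕ} {x : Pairing (n + 1)} {i j : Letters n}
    (h : x.partner (incl i) = incl j) : projFun x i = j := by
  have h' : (x.partner (incl i)).1 ∈ letters n := by rw [h]; exact j.2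
  unfold projFun
  rw [dif_pos h']
  apply incl_injective
  rw [← h]; rfl

theorem projFun_out {n : ℕ} {x : Pairing (n + 1)} {i j : Letters n} {k : Letters (n + 1)}
    (hk : k = top n ∨ k = flip (n + 1) (top n))
    (h : x.partner (incl i) = k) (h2 : x.partner (flip (n + 1) k) = incl j) :
    projFun x i = j := by
  have h' : (x.partner (incl i)).1 ∉ letters n := by rw [h, not_mem_iff]; exact hk
  unfold projFun
  rw [dif_neg h']
  apply incl_injective
  rw [← h2, ← h]; rfl

theorem projFun_cases {n : ℕ} (x : Pairing (n + 1)) (i : Letters n) :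
    x.partner (incl i) = incl (projFun x i) ∨
    ∃ k, (k = top n ∨ k = flip (n + 1) (top n)) ∧ x.partner (incl i) = k ∧
      x.partner (flip (n + 1) k) = incl (projFun x i) := by
  by_cases h : (x.partner (incl i)).1 ∈ letters n
  · left
    have : x.partner (incl i) = incl ⟨_, h⟩ := rfl
    rw [projFun_in this]; rfl
  · right
    refine ⟨_, (not_mem_iff _).1 h, rfl, ?_⟩
    have h2 : x.partner (flip (n + 1) (x.partner (incl i))) = incl ⟨_, proj_aux x i h⟩ := rfl
    rw [projFun_out ((not_mem_iff _).1 h) rfl h2]; rfl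

theorem flip_out {n : ℕ} {k : Letters (n + 1)} (hk : k = top n ∨ k = flip (n + 1) (top n)) :
    flip (n + 1) k = top n ∨ flip (n + 1) k = flip (n + 1) (top n) := by
  rcases hk with rfl | rfl
  · exact Or.inr rfl
  · exact Or.inl (flip_flip _)

/-- The canonical projection `p_{n,n+1} : X(n+1) → X(n)`: a pair `{-n-1, n+1}` is deleted, and two
pairs `{i, -n-1}`, `{k, n+1}` are replaced by `{i, k}`. -/
def proj {n : ℕ} (x : Pairing (n + 1)) : Pairing n where
  partner := projFun x
  partner_partner i := by
    rcases projFun_cases x i with h | ⟨k, hk, h1, h2⟩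
    · apply projFun_in
      rw [← h, x.partner_partner]
    · refine projFun_out (flip_out hk) ?_ ?_
      · rw [← h2, x.partner_partner]
      · rw [flip_flip, ← h1, x.partner_partner]
  partner_ne i h := by
    rcases projFun_cases x i with h' | ⟨k, hk, h1, h2⟩
    · rw [h] at h'; exact x.partner_ne _ h'
    · rw [h, ← h1] at h2
      have := congrArg x.partner h2
      rw [x.partner_partner, h1] at this
      exact flip_ne k this

theorem proj_in {n : ℕ} {x : Pairing (n + 1)} {i j : Letters n}
    (h : x.partner (incl i) = incl j) : (proj x).partner i = j := projFun_in h

theorem proj_out {n : ℕ} {x : Pairing (n + 1)} {i j : Letters n} {k : Letters (n + 1)}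
    (hk : k = top n ∨ k = flip (n + 1) (top n))
    (h : x.partner (incl i) = k) (h2 : x.partner (flip (n + 1) k) = incl j) :
    (proj x).partner i = j := projFun_out hk h h2

theorem proj_cases {n : ℕ} (x : Pairing (n + 1)) (i : Letters n) :
    x.partner (incl i) = incl ((proj x).partner i) ∨
    ∃ k, (k = top n ∨ k = flip (n + 1) (top n)) ∧ x.partner (incl i) = k ∧
      x.partner (flip (n + 1) k) = incl ((proj x).partner i) := projFun_cases x i


theorem circles_proj {n : ℕ} (x : Pairing (n + 1)) :
    x.circles = (proj x).circles + if x.partner (top n) = flip (n + 1) (top n) then 1 else 0 := by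
  have sp : ∀ i, Quot.mk x.step i = Quot.mk x.step (x.partner i) :=
    fun i => Quot.sound (Or.inl rfl)
  have sf : ∀ i, Quot.mk x.step i = Quot.mk x.step (flip (n + 1) i) :=
    fun i => Quot.sound (Or.inr rfl)
  have hstep : ∀ i j, (proj x).step i j →
      Quot.mk x.step (incl i) = Quot.mk x.step (incl j) := by
    rintro i j (rfl | rfl)
    · rcases proj_cases x i with h | ⟨k, hk, h1, h2⟩
      · rw [← h]; exact Quot.sound (Or.inl rfl)
      · rw [← h2, ← sp, ← sf, ← h1, ← sp]
    · rw [← flip_incl, ← sf]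
  by_cases hp : x.partner (top n) = flip (n + 1) (top n)
  · rw [if_pos hp]
    have hp2 : x.partner (flip (n + 1) (top n)) = top n := by rw [← hp, x.partner_partner]
    have hin : ∀ i, x.partner (incl i) = incl ((proj x).partner i) := by
      intro i
      rcases proj_cases x i with h | ⟨k, hk, h1, h2⟩
      · exact h
      · exfalso
        have h3 := x.partner_partner (incl i)
        rcases hk with rfl | rfl
        · rw [h1, hp] at h3; exact incl_ne_bot i h3.symm
        · rw [h1, hp2] at h3; exact incl_ne_top i h3.symm
    classical
    let d : Letters (n + 1) → Option (Quot (proj x).step) := fun k =>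
      if h : k.1 ∈ letters n then some (Quot.mk _ ⟨k.1, h⟩) else none
    have d_incl : ∀ i : Letters n, d (incl i) = some (Quot.mk _ i) := fun i => dif_pos i.2
    have d_top : d (top n) = none := dif_neg ((not_mem_iff _).2 (Or.inl rfl))
    have d_bot : d (flip (n + 1) (top n)) = none := dif_neg ((not_mem_iff _).2 (Or.inr rfl))
    have hd : ∀ i j, x.step i j → d i = d j := by
      rintro i j (rfl | rfl)
      · rcases letters_cases i with ⟨i, rfl⟩ | rfl | rfl
        · rw [hin, d_incl, d_incl]; exact congrArg some (Quot.sound (Or.inl rfl))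
        · rw [hp, d_top, d_bot]
        · rw [hp2, d_top, d_bot]
      · rcases letters_cases i with ⟨i, rfl⟩ | rfl | rfl
        · rw [flip_incl, d_incl, d_incl]; exact congrArg some (Quot.sound (Or.inr rfl))
        · rw [d_top, d_bot]
        · rw [flip_flip, d_top, d_bot]
    let e : Quot x.step ≃ Option (Quot (proj x).step) :=
      { toFun := Quot.lift d hd
        invFun := fun o => o.elim (Quot.mk _ (top n))
          (Quot.lift (fun i => Quot.mk _ (incl i)) hstep)
        left_inv := by
          rintro ⟨i⟩
          rcases letters_cases i with ⟨i, rfl⟩ | rfl | rfl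
          · change Option.elim (d (incl i)) _ _ = _
            rw [d_incl]; rfl
          · change Option.elim (d (top n)) _ _ = _
            rw [d_top]; rfl
          · change Option.elim (d (flip (n + 1) (top n))) _ _ = _
            rw [d_bot]; exact Quot.sound (Or.inr rfl)
        right_inv := by
          rintro (_ | ⟨i⟩)
          · exact d_top
          · induction i using Quot.ind
            exact d_incl _ }
    unfold Pairing.circles
    rw [Nat.card_congr e, Finite.card_option]
  · rw [if_neg hp, add_zero]
    have hb : ∀ k : Letters (n + 1), (k = top n ∨ k = flip (n + 1) (top n)) →
        ∃ a, x.partner k = incl a := by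
      intro k hk
      rcases letters_cases (x.partner k) with h | h | h
      · exact h
      · rcases hk with rfl | rfl
        · exact absurd h (x.partner_ne _)
        · exact absurd (by
            conv_lhs => rw [← h]
            rw [x.partner_partner]) hp
      · rcases hk with rfl | rfl
        · exact absurd h hp
        · exact absurd h (x.partner_ne _)
    obtain ⟨a, ha⟩ := hb _ (Or.inl rfl)
    obtain ⟨b, hb⟩ := hb _ (Or.inr rfl)
    have ha' : x.partner (incl a) = top n := by rw [← ha, x.partner_partner]
    have hb' : x.partner (incl b) = flip (n + 1) (top n) := by rw [← hb, x.partner_partner]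
    have hab : (proj x).partner a = b := proj_out (Or.inl rfl) ha' hb
    classical
    let d : Letters (n + 1) → Quot (proj x).step := fun k =>
      if h : k.1 ∈ letters n then Quot.mk _ ⟨k.1, h⟩ else Quot.mk _ a
    have d_incl : ∀ i : Letters n, d (incl i) = Quot.mk _ i := fun i => dif_pos i.2
    have d_top : d (top n) = Quot.mk _ a := dif_neg ((not_mem_iff _).2 (Or.inl rfl))
    have d_bot : d (flip (n + 1) (top n)) = Quot.mk _ a :=
      dif_neg ((not_mem_iff _).2 (Or.inr rfl))
    have hqab : (Quot.mk _ a : Quot (proj x).step) = Quot.mk _ b := Quot.sound (Or.inl hab.symm)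
    have hd : ∀ i j, x.step i j → d i = d j := by
      rintro i j (rfl | rfl)
      · rcases letters_cases i with ⟨i, rfl⟩ | rfl | rfl
        · rcases proj_cases x i with h | ⟨k, hk, h1, h2⟩
          · rw [h, d_incl, d_incl]; exact Quot.sound (Or.inl rfl)
          · have h3 := x.partner_partner (incl i)
            rcases hk with rfl | rfl
            · rw [h1, ha] at h3
              rw [h1, d_top, d_incl, incl_injective h3]
            · rw [h1, hb] at h3
              rw [h1, d_bot, d_incl, ← incl_injective h3, hqab]
        · rw [ha, d_top, d_incl]
        · rw [hb, d_bot, d_incl, hqab]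
      · rcases letters_cases i with ⟨i, rfl⟩ | rfl | rfl
        · rw [flip_incl, d_incl, d_incl]; exact Quot.sound (Or.inr rfl)
        · rw [d_top, d_bot]
        · rw [flip_flip, d_top, d_bot]
    let e : Quot x.step ≃ Quot (proj x).step :=
      { toFun := Quot.lift d hd
        invFun := Quot.lift (fun i => Quot.mk _ (incl i)) hstep
        left_inv := by
          rintro ⟨i⟩
          have key : ∀ k : Letters (n + 1), d k = Quot.mk _ a →
              (Quot.mk x.step k = Quot.mk _ (incl a)) →
              Quot.lift (fun i => Quot.mk x.step (incl i)) hstep (d k) = Quot.mk _ k := by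
            intro k h1 h2
            rw [h1, h2]
          have htop : Quot.mk x.step (top n) = Quot.mk _ (incl a) := Quot.sound (Or.inl ha.symm)
          rcases letters_cases i with ⟨i, rfl⟩ | rfl | rfl
          · change Quot.lift _ _ (d (incl i)) = _
            rw [d_incl]
          · exact key _ d_top htop
          · exact key _ d_bot ((sf _).symm.trans htop)
        right_inv := by
          rintro ⟨i⟩
          exact d_incl i }
    exact Nat.card_congr e

/-- The way in which `{n+1, -n-1}` sits in a pairing: `none` if it is a pair, and otherwise the
partner of `n + 1`. -/
def code {n : ℕ} (x : Pairing (n + 1)) : Option (Letters n) := by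
  classical
  exact if h : (x.partner (top n)).1 ∈ letters n then some ⟨_, h⟩ else none

theorem code_eq_some {n : ℕ} {x : Pairing (n + 1)} {a : Letters n} :
    code x = some a ↔ x.partner (top n) = incl a := by
  unfold code
  split_ifs with h
  · rw [Option.some_inj]
    exact ⟨fun h' => by rw [← h']; rfl, fun h' => Subtype.ext (show (x.partner (top n)).1 = (incl a).1 by rw [h'])⟩
  · refine ⟨fun h' => (by simp at h'), fun h' => absurd ?_ h⟩
    rw [h']; exact a.2

theorem code_eq_none {n : ℕ} {x : Pairing (n + 1)} :
    code x = none ↔ x.partner (top n) = flip (n + 1) (top n) := by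
  unfold code
  split_ifs with h
  · refine ⟨fun h' => (by simp at h'), fun h' => absurd h ?_⟩
    exact (not_mem_iff _).2 (Or.inr h')
  · refine ⟨fun _ => ?_, fun _ => rfl⟩
    rcases (not_mem_iff _).1 h with h' | h'
    · exact absurd h' (x.partner_ne _)
    · exact h'

theorem ext_of_proj_code {n : ℕ} {x y : Pairing (n + 1)} (h : proj x = proj y)
    (hc : code x = code y) : x = y := by
  have key : ∀ x y : Pairing (n + 1), proj x = proj y → code x = code y →
      x.partner (top n) = y.partner (top n) ∧
      x.partner (flip (n + 1) (top n)) = y.partner (flip (n + 1) (top n)) := by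
    intro x y h hc
    rcases hx : code x with _ | a
    · have hy : code y = none := hc ▸ hx
      rw [code_eq_none] at hx hy
      refine ⟨hx.trans hy.symm, ?_⟩
      have h1 := x.partner_partner (top n)
      have h2 := y.partner_partner (top n)
      rw [hx] at h1; rw [hy] at h2
      rw [h1, h2]
    · have hy : code y = some a := hc ▸ hx
      rw [code_eq_some] at hx hy
      refine ⟨hx.trans hy.symm, ?_⟩
      have aux : ∀ w : Pairing (n + 1), w.partner (top n) = incl a →
          w.partner (flip (n + 1) (top n)) = incl ((proj w).partner a) := by
        intro w hw
        have hw' : w.partner (incl a) = top n := by rw [← hw, w.partner_partner]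
        rcases proj_cases w a with h1 | ⟨k, hk, h1, h2⟩
        · rw [hw'] at h1; exact absurd h1.symm (incl_ne_top _)
        · rw [hw'] at h1; subst h1; exact h2
      rw [aux x hx, aux y hy, h]
  obtain ⟨h1, h2⟩ := key x y h hc
  apply Pairing.ext
  funext k
  rcases letters_cases k with ⟨i, rfl⟩ | rfl | rfl
  · have aux : ∀ w v : Pairing (n + 1), w.partner (top n) = v.partner (top n) →
        w.partner (flip (n + 1) (top n)) = v.partner (flip (n + 1) (top n)) →
        ∀ k, (k = top n ∨ k = flip (n + 1) (top n)) → w.partner (incl i) = k →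
          w.partner (incl i) = v.partner (incl i) := by
      intro w v e1 e2 k hk hw
      have h3 : w.partner k = v.partner k := by rcases hk with rfl | rfl <;> assumption
      have h4 : v.partner k = incl i := by rw [← h3, ← hw, w.partner_partner]
      rw [← h4, v.partner_partner, h4, hw]
    rcases proj_cases x i with h3 | ⟨k, hk, h3, -⟩
    · rcases proj_cases y i with h4 | ⟨k, hk, h4, -⟩
      · rw [h3, h4, h]
      · exact (aux y x h1.symm h2.symm k hk h4).symm
    · exact aux x y h1 h2 k hk h3
  · exact h1
  · exact h2

theorem exists_insert {n : ℕ} (x : Pairing n) (c : Option (Letters n)) :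
    ∃ y : Pairing (n + 1), proj y = x ∧ code y = c := by
  classical
  have hft : flip (n + 1) (top n) ≠ top n := flip_ne _
  have nt : (top n).1 ∉ letters n := (not_mem_iff _).2 (Or.inl rfl)
  have nb : (flip (n + 1) (top n)).1 ∉ letters n := (not_mem_iff _).2 (Or.inr rfl)
  rcases c with _ | a
  · let f : Letters (n + 1) → Letters (n + 1) := fun k =>
      if h : k.1 ∈ letters n then incl (x.partner ⟨k.1, h⟩) else flip (n + 1) k
    have f_incl : ∀ i, f (incl i) = incl (x.partner i) := fun i => dif_pos i.2
    have f_top : f (top n) = flip (n + 1) (top n) := dif_neg nt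
    have f_bot : f (flip (n + 1) (top n)) = top n := (dif_neg nb).trans (flip_flip _)
    let y : Pairing (n + 1) :=
      { partner := f
        partner_partner := fun k => by
          rcases letters_cases k with ⟨i, rfl⟩ | rfl | rfl
          · rw [f_incl, f_incl, x.partner_partner]
          · rw [f_top, f_bot]
          · rw [f_bot, f_top]
        partner_ne := fun k => by
          rcases letters_cases k with ⟨i, rfl⟩ | rfl | rfl
          · rw [f_incl]; exact fun h => x.partner_ne i (incl_injective h)
          · rw [f_top]; exact hft
          · rw [f_bot]; exact hft.symm }
    refine ⟨y, Pairing.ext (funext fun i => proj_in (f_incl i)), code_eq_none.2 f_top⟩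
  · let f : Letters (n + 1) → Letters (n + 1) := fun k =>
      if h : k.1 ∈ letters n then
        if k = incl a then top n
        else if k = incl (x.partner a) then flip (n + 1) (top n)
        else incl (x.partner ⟨k.1, h⟩)
      else if k = top n then incl a else incl (x.partner a)
    have hpa : incl (x.partner a) ≠ incl a := fun h => x.partner_ne a (incl_injective h)
    have f_a : f (incl a) = top n := by
      exact (dif_pos (show (incl a).1 ∈ letters n from a.2)).trans (if_pos rfl)
    have f_pa : f (incl (x.partner a)) = flip (n + 1) (top n) := by
      exact (dif_pos (show (incl (x.partner a)).1 ∈ letters n from (x.partner a).2)).trans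
        ((if_neg hpa).trans (if_pos rfl))
    have f_incl : ∀ i, i ≠ a → i ≠ x.partner a → f (incl i) = incl (x.partner i) := by
      intro i h1 h2
      exact (dif_pos (show (incl i).1 ∈ letters n from i.2)).trans
        ((if_neg (fun h => h1 (incl_injective h))).trans
          (if_neg (fun h => h2 (incl_injective h))))
    have f_top : f (top n) = incl a := by
      exact (dif_neg nt).trans (if_pos rfl)
    have f_bot : f (flip (n + 1) (top n)) = incl (x.partner a) := by
      exact (dif_neg nb).trans (if_neg hft)
    let y : Pairing (n + 1) :=
      { partner := f
        partner_partner := fun k => by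
          rcases letters_cases k with ⟨i, rfl⟩ | rfl | rfl
          · by_cases h1 : i = a
            · subst h1; rw [f_a, f_top]
            by_cases h2 : i = x.partner a
            · subst h2; rw [f_pa, f_bot]
            rw [f_incl i h1 h2, f_incl, x.partner_partner]
            · exact fun h => h2 (by rw [← h, x.partner_partner])
            · intro h
              apply h1
              rw [← x.partner_partner i, h, x.partner_partner]
          · rw [f_top, f_a]
          · rw [f_bot, f_pa]
        partner_ne := fun k => by
          rcases letters_cases k with ⟨i, rfl⟩ | rfl | rfl
          · by_cases h1 : i = a
            · subst h1; rw [f_a]; exact (incl_ne_top _).symm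
            by_cases h2 : i = x.partner a
            · subst h2; rw [f_pa]; exact (incl_ne_bot _).symm
            rw [f_incl i h1 h2]
            exact fun h => x.partner_ne i (incl_injective h)
          · rw [f_top]; exact incl_ne_top _
          · rw [f_bot]; exact incl_ne_bot _ }
    refine ⟨y, Pairing.ext (funext fun i => ?_), code_eq_some.2 f_top⟩
    by_cases h1 : i = a
    · subst h1
      exact proj_out (x := y) (Or.inl rfl) f_a f_bot
    by_cases h2 : i = x.partner a
    · subst h2
      rw [x.partner_partner]
      exact proj_out (x := y) (Or.inr rfl) f_pa (by rw [flip_flip]; exact f_top)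
    exact proj_in (x := y) (f_incl i h1 h2)

theorem proj_smul {n : ℕ} {g : Perm (Letters (n + 1))} {h : Perm (Letters n)}
    (hi : ∀ i, g (incl i) = incl (h i)) (ht : g (top n) = top n)
    (hb : g (flip (n + 1) (top n)) = flip (n + 1) (top n)) (x : Pairing (n + 1)) :
    proj (g • x) = h • proj x := by
  apply Pairing.ext
  funext i
  obtain ⟨j, rfl⟩ := h.surjective i
  rw [smul_partner']
  rcases proj_cases x j with h1 | ⟨k, hk, h1, h2⟩
  · apply proj_in
    rw [← hi, smul_partner', h1, hi]
  · have hk1 : g k = k := by rcases hk with rfl | rfl <;> assumption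
    have hk2 : g (flip (n + 1) k) = flip (n + 1) k := by
      rcases flip_out hk with h | h <;> rw [h] <;> assumption
    refine proj_out hk ?_ ?_
    · rw [← hi, smul_partner', h1, hk1]
    · conv_lhs => rw [← hk2]
      rw [smul_partner', h2, hi]

theorem smul_partner_top_iff {n : ℕ} {g : Perm (Letters (n + 1))} (ht : g (top n) = top n)
    (hb : g (flip (n + 1) (top n)) = flip (n + 1) (top n)) (x : Pairing (n + 1)) :
    (g • x).partner (top n) = flip (n + 1) (top n) ↔
      x.partner (top n) = flip (n + 1) (top n) := by
  conv_lhs => lhs; rw [← ht]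
  conv_lhs => rhs; rw [← hb]
  rw [smul_partner']
  exact g.injective.eq_iff


/-! ### The projective limit `X` and the group `S(2∞)` -/

/-- The projective limit `X = lim X(n)`. -/
def XLim : Type := {x : ∀ n, Pairing n // ∀ n, proj (x (n + 1)) = x n}

/-- The projection `p_n : X → X(n)`. -/
def XLim.p (n : ℕ) (x : XLim) : Pairing n := x.1 n

theorem XLim.proj_p (x : XLim) (n : ℕ) : proj (x.p (n + 1)) = x.p n := x.2 n

/-- The Borel structure of `X`, generated by the projections `p_n`. -/
instance : MeasurableSpace XLim := MeasurableSpace.comap Subtype.val inferInstance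

theorem XLim.measurable_p (n : ℕ) : Measurable (XLim.p n) :=
  (measurable_pi_apply n).comp (comap_measurable Subtype.val)

theorem XLim.measurable_of_p {α : Type*} [MeasurableSpace α] {f : α → XLim}
    (h : ∀ n, Measurable fun a => (f a).p n) : Measurable f :=
  measurable_comap_iff.2 (measurable_pi_iff.2 h)

theorem XLim.ext_tail {x y : XLim} (N : ℕ) (h : ∀ n, N ≤ n → x.p n = y.p n) : x = y := by
  induction N with
  | zero => exact Subtype.ext (funext fun n => h n n.zero_le)
  | succ N ih =>
    apply ih
    intro n hn
    rcases Nat.lt_or_ge N n with h1 | h1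
    · exact h n h1
    · obtain rfl : n = N := le_antisymm h1 hn
      rw [← x.proj_p, ← y.proj_p, h _ le_rfl]

theorem XLim.exists_of_tail (N : ℕ) (y : ∀ n, Pairing n)
    (h : ∀ n, N ≤ n → proj (y (n + 1)) = y n) : ∃ x : XLim, ∀ n, N ≤ n → x.p n = y n := by
  induction N generalizing y with
  | zero => exact ⟨⟨y, fun n => h n n.zero_le⟩, fun _ _ => rfl⟩
  | succ N ih =>
    obtain ⟨x, hx⟩ := ih (fun n => proj (y (n + 1))) (fun n hn => by rw [h (n + 1) (by omega)])
    exact ⟨x, fun n hn => by rw [hx n (by omega), h n hn]⟩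

theorem XLim.eq_of_p_eq {x y : XLim} {m n : ℕ} (h : m ≤ n) (hp : x.p n = y.p n) :
    x.p m = y.p m := by
  induction n, h using Nat.le_induction with
  | base => exact hp
  | succ n hn ih => exact ih (by rw [← x.proj_p, ← y.proj_p, hp])

/-- `g` belongs to the subgroup `S(2n)` of permutations moving only `-n, …, -1, 1, …, n`. -/
def Supported (n : ℕ) (g : Perm ℤ) : Prop := ∀ k, k ∉ letters n → g k = k

theorem Supported.mono {m n : ℕ} (h : m ≤ n) {g : Perm ℤ} (hg : Supported m g) :
    Supported n g := fun k hk => hg k fun hk' => hk (letters_mono h hk')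

theorem Supported.mul {n : ℕ} {g h : Perm ℤ} (hg : Supported n g) (hh : Supported n h) :
    Supported n (g * h) := fun k hk => by rw [Perm.mul_apply, hh k hk, hg k hk]

theorem Supported.inv {n : ℕ} {g : Perm ℤ} (hg : Supported n g) : Supported n g⁻¹ :=
  fun k hk => by rw [Perm.inv_eq_iff_eq, hg k hk]

theorem Supported.mem_iff {n : ℕ} {g : Perm ℤ} (hg : Supported n g) (k : ℤ) :
    g k ∈ letters n ↔ k ∈ letters n := by
  constructor
  · intro h
    by_contra h'
    rw [hg k h'] at h
    exact h' h
  · intro h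
    by_contra h'
    rw [g.injective (hg _ h')] at h'
    exact h' h

/-- The group `S(2∞)`, the union of the groups `S(2n)`. -/
def S2inf : Subgroup (Perm ℤ) where
  carrier := {g | ∃ n, Supported n g}
  one_mem' := ⟨0, fun _ _ => rfl⟩
  mul_mem' := by
    rintro g h ⟨m, hm⟩ ⟨n, hn⟩
    exact ⟨max m n, (hm.mono (le_max_left _ _)).mul (hn.mono (le_max_right _ _))⟩
  inv_mem' := by
    rintro g ⟨m, hm⟩
    exact ⟨m, hm.inv⟩

theorem supported_ofSubtype {n : ℕ} (g : Perm (Letters n)) : Supported n (Perm.ofSubtype g) :=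
  fun _ hk => Perm.ofSubtype_apply_of_not_mem g hk

/-- The inclusion `S(2n) → S(2∞)`. -/
def toS2inf (n : ℕ) : Perm (Letters n) →* S2inf :=
  (Perm.ofSubtype : Perm (Letters n) →* Perm ℤ).codRestrict S2inf
    fun g => ⟨n, supported_ofSubtype g⟩

/-- An element of `S(2n) ⊆ S(2∞)` as a permutation of `{-n, …, -1, 1, …, n}` (the identity if `g`
does not lie in `S(2n)`). -/
def restr (n : ℕ) (g : Perm ℤ) : Perm (Letters n) := by
  classical
  exact if h : Supported n g then g.subtypePerm h.mem_iff else 1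

theorem restr_apply {n : ℕ} {g : Perm ℤ} (h : Supported n g) (i : Letters n) :
    (restr n g i).1 = g i.1 := by
  unfold restr
  rw [dif_pos h]; rfl

theorem restr_mul {n : ℕ} {g h : Perm ℤ} (hg : Supported n g) (hh : Supported n h) :
    restr n (g * h) = restr n g * restr n h := by
  ext i
  rw [restr_apply (hg.mul hh), Perm.mul_apply, Perm.mul_apply, restr_apply hg, restr_apply hh]

theorem restr_one (n : ℕ) : restr n 1 = 1 := by
  ext i
  rw [restr_apply (fun _ _ => rfl)]; rfl

theorem restr_toS2inf {n : ℕ} (g : Perm (Letters n)) : restr n (toS2inf n g : Perm ℤ) = g := by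
  ext i
  exact (restr_apply (supported_ofSubtype g) i).trans (Perm.ofSubtype_apply_coe g i)

theorem restr_incl {n : ℕ} {g : Perm ℤ} (hg : Supported n g) (i : Letters n) : restr (n + 1) g (incl i) = incl (restr n g i) :=
  Subtype.ext (by
    rw [restr_apply (hg.mono n.le_succ)]
    exact (restr_apply hg i).symm)

theorem restr_out {n : ℕ} {g : Perm ℤ} (hg : Supported n g) {k : Letters (n + 1)}
    (hk : k = top n ∨ k = flip (n + 1) (top n)) :
    restr (n + 1) g k = k :=
  Subtype.ext (by
    rw [restr_apply (hg.mono n.le_succ)]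
    exact hg _ ((not_mem_iff k).2 hk))

/-- The projections are equivariant. -/
theorem proj_restr_smul {n : ℕ} {g : Perm ℤ} (hg : Supported n g) (x : Pairing (n + 1)) :
    proj (restr (n + 1) g • x) = restr n g • proj x :=
  proj_smul (restr_incl hg) (restr_out hg (Or.inl rfl)) (restr_out hg (Or.inr rfl)) x

theorem circles_diff_succ {n : ℕ} {g : Perm ℤ} (hg : Supported n g) (x : Pairing (n + 1)) :
    ((restr (n + 1) g • x).circles : ℤ) - x.circles =
      ((restr n g • proj x).circles : ℤ) - (proj x).circles := by
  rw [circles_proj (restr (n + 1) g • x), circles_proj x, proj_restr_smul hg]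
  simp only [smul_partner_top_iff (restr_out hg (Or.inl rfl)) (restr_out hg (Or.inr rfl))]
  push_cast
  ring

/-- The least `n` with `g ∈ S(2n)`. -/
def level (g : S2inf) : ℕ := by
  classical
  exact Nat.find g.2

theorem supported_level (g : S2inf) : Supported (level g) (g : Perm ℤ) := by
  classical
  exact Nat.find_spec g.2

theorem level_le {g : S2inf} {n : ℕ} (h : Supported n (g : Perm ℤ)) : level g ≤ n := by
  classical
  exact Nat.find_min' g.2 h

theorem XLim.exists_smul (g : S2inf) (x : XLim) :
    ∃ y : XLim, ∀ n, level g ≤ n → y.p n = restr n (g : Perm ℤ) • x.p n :=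
  XLim.exists_of_tail (level g) (fun n => restr n (g : Perm ℤ) • x.p n) fun n hn => by
    rw [proj_restr_smul ((supported_level g).mono hn), x.proj_p]

instance : SMul S2inf XLim := ⟨fun g x => (XLim.exists_smul g x).choose⟩

theorem XLim.p_smul {g : S2inf} {n : ℕ} (h : Supported n (g : Perm ℤ)) (x : XLim) :
    (g • x).p n = restr n (g : Perm ℤ) • x.p n :=
  (XLim.exists_smul g x).choose_spec n (level_le h)

/-- The action of `S(2∞)` on `X`: `(x · g)_n = x_n · g` for all `n` with `g ∈ S(2n)`.  As for
`X(n)`, the right action `x · g` of the literature is written `g • x`. -/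
instance : MulAction S2inf XLim where
  one_smul x := by
    apply XLim.ext_tail 0
    intro n _
    rw [XLim.p_smul (fun _ _ => rfl)]
    exact (congrArg (· • x.p n) (restr_one n)).trans (one_smul _ _)
  mul_smul g h x := by
    apply XLim.ext_tail (max (level g) (level h))
    intro n hn
    have hg : Supported n (g : Perm ℤ) :=
      (supported_level g).mono ((le_max_left _ _).trans hn)
    have hh : Supported n (h : Perm ℤ) :=
      (supported_level h).mono ((le_max_right _ _).trans hn)
    rw [XLim.p_smul hg, XLim.p_smul hh, XLim.p_smul (hg.mul hh), smul_smul, ← restr_mul hg hh]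
    rfl

/-- The fundamental cocycle `c(x; g) = [x_n · g]_n - [x_n]_n`, where `n` is so large that
`g ∈ S(2n)` (see `cocycle_eq` for the independence of `n`). -/
def cocycle (x : XLim) (g : S2inf) : ℤ :=
  (((g • x).p (level g)).circles : ℤ) - (x.p (level g)).circles

theorem cocycle_eq {g : S2inf} {n : ℕ} (h : Supported n (g : Perm ℤ)) (x : XLim) :
    cocycle x g = (((g • x).p n).circles : ℤ) - (x.p n).circles := by
  have h' := level_le h
  clear h
  induction n, h' using Nat.le_induction with
  | base => rfl
  | succ n hn ih =>
    have hs := (supported_level g).mono hn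
    rw [ih, XLim.p_smul hs, XLim.p_smul (hs.mono n.le_succ), circles_diff_succ hs, x.proj_p]

theorem cocycle_one (x : XLim) : cocycle x 1 = 0 := by
  rw [cocycle, one_smul, sub_self]

theorem cocycle_mul (x : XLim) (g h : S2inf) :
    cocycle x (g * h) = cocycle (h • x) g + cocycle x h := by
  have hg := (supported_level g).mono (le_max_left (level g) (level h))
  have hh := (supported_level h).mono (le_max_right (level g) (level h))
  rw [cocycle_eq (hg.mul hh : Supported _ ((g * h : S2inf) : Perm ℤ)), cocycle_eq hg,
    cocycle_eq hh, mul_smul]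
  ring

theorem XLim.exists_supported (g : S2inf) (m : ℕ) : ∃ n, m ≤ n ∧ Supported n (g : Perm ℤ) :=
  ⟨max m (level g), le_max_left _ _, (supported_level g).mono (le_max_right _ _)⟩


/-! ### The measures `μ_t` -/

/-- The weight `μ_t^{(n)}(x) = t^{[x]ₙ} / (t (t + 2) ⋯ (t + 2n - 2))`. -/
def weight (t : ℝ) {n : ℕ} (x : Pairing n) : ℝ :=
  t ^ x.circles / ∏ k ∈ Finset.range n, (t + 2 * k)

theorem card_letters (n : ℕ) : Fintype.card (Letters n) = 2 * n := by
  rw [Fintype.card_coe, letters, Finset.card_erase_of_mem (by simp), Int.card_Icc]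
  omega

instance : Subsingleton (Pairing 0) :=
  ⟨fun x y => Pairing.ext (funext fun i => by
    have := Fintype.card_eq_zero_iff.1 (card_letters 0)
    exact this.elim i)⟩

theorem weight_zero (t : ℝ) (x : Pairing 0) : weight t x = 1 := by
  have := Fintype.card_eq_zero_iff.1 (card_letters 0)
  have h : x.circles = 0 := by
    unfold Pairing.circles
    have : IsEmpty (Quot x.step) := ⟨fun q => by
      induction q using Quot.ind with
      | mk i => exact this.elim i⟩
    exact Nat.card_of_isEmpty
  simp [weight, h]

theorem weight_succ {t : ℝ} (ht : 0 < t) {n : ℕ} (x : Pairing (n + 1)) :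
    weight t x = weight t (proj x) * (code x).elim (t / (t + 2 * n)) (fun _ => 1 / (t + 2 * n)) := by
  have h1 : t + 2 * (n : ℝ) ≠ 0 := by positivity
  have h2 : ∏ k ∈ Finset.range n, (t + 2 * (k : ℝ)) ≠ 0 :=
    Finset.prod_ne_zero_iff.2 fun k _ => by positivity
  unfold weight
  rw [circles_proj x, Finset.prod_range_succ]
  rcases h : code x with _ | a
  · rw [if_pos (code_eq_none.1 h), pow_succ]
    simp only [Option.elim_none]
    field_simp
  · rw [if_neg (fun h' => by rw [code_eq_none.2 h'] at h; simp at h)]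
    simp only [Option.elim_some, add_zero]
    field_simp

theorem exists_ewens {t : ℝ} (ht : 0 < t) : ∃ μ : Measure XLim, IsProbabilityMeasure μ ∧
    ∀ (n : ℕ) (x : Pairing n), μ (XLim.p n ⁻¹' {x}) = ENNReal.ofReal (weight t x) := by
  classical
  let _ : ∀ k, MeasurableSpace (Option (Letters k)) := fun _ => ⊤
  have _ : ∀ k, DiscreteMeasurableSpace (Option (Letters k)) := fun _ => ⟨fun _ => trivial⟩
  let f : ∀ k : ℕ, Option (Letters k) → ℝ :=
    fun k o => o.elim (t / (t + 2 * k)) (fun _ => 1 / (t + 2 * k))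
  have f_nonneg : ∀ k o, 0 ≤ f k o := by
    intro k o
    rcases o with _ | a <;> simp only [f, Option.elim_none, Option.elim_some] <;> positivity
  have f_sum : ∀ k, ∑ o, f k o = 1 := by
    intro k
    have h1 : t + 2 * (k : ℝ) ≠ 0 := by positivity
    simp only [f, Fintype.sum_option, Option.elim_none, Option.elim_some, Finset.sum_const,
      Finset.card_univ, card_letters, nsmul_eq_mul]
    push_cast
    field_simp
  let q : ∀ k, PMF (Option (Letters k)) := fun k =>
    PMF.ofFintype (fun o => ENNReal.ofReal (f k o)) (by
      rw [← ENNReal.ofReal_sum_of_nonneg (fun o _ => f_nonneg k o), f_sum, ENNReal.ofReal_one])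
  let ν : Measure (∀ k, Option (Letters k)) := Measure.infinitePi fun k => (q k).toMeasure
  choose ins ins_proj ins_code using fun n => @exists_insert n
  let dec : (∀ k, Option (Letters k)) → ∀ n, Pairing n := fun ω n =>
    Nat.rec (basePairing 0) (fun n x => ins n x (ω n)) n
  have dec_succ : ∀ ω n, dec ω (n + 1) = ins n (dec ω n) (ω n) := fun _ _ => rfl
  have key : ∀ n (x : Pairing n), ∃ a : ∀ k, Option (Letters k),
      (∀ ω, dec ω n = x ↔ ∀ k ∈ Finset.range n, ω k = a k) ∧
      ∏ k ∈ Finset.range n, f k (a k) = weight t x := by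
    intro n
    induction n with
    | zero =>
      intro x
      refine ⟨fun _ => none, fun ω => ⟨fun _ => by simp, fun _ => Subsingleton.elim _ _⟩, ?_⟩
      rw [weight_zero]; simp
    | succ n ih =>
      intro x
      obtain ⟨a, ha, hw⟩ := ih (proj x)
      have hne : ∀ k ∈ Finset.range n, Function.update a n (code x) k = a k := fun k hk =>
        Function.update_of_ne (Finset.mem_range.1 hk).ne _ _
      refine ⟨Function.update a n (code x), fun ω => ?_, ?_⟩
      · rw [Finset.range_add_one, Finset.forall_mem_insert, Function.update_self, dec_succ]
        have h2 : (∀ k ∈ Finset.range n, ω k = Function.update a n (code x) k) ↔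
            dec ω n = proj x := by
          rw [ha]
          exact forall₂_congr fun k hk => by rw [hne k hk]
        rw [h2]
        constructor
        · rintro h
          rw [← h, ins_proj, ins_code]
          exact ⟨rfl, rfl⟩
        · rintro ⟨h3, h4⟩
          apply ext_of_proj_code
          · rw [ins_proj, h4]
          · rw [ins_code, h3]
      · rw [Finset.prod_range_succ, Function.update_self, weight_succ ht, ← hw]
        congr 1
        exact Finset.prod_congr rfl fun k hk => by rw [hne k hk]
  have hset : ∀ n (x : Pairing n), MeasurableSet {ω | dec ω n = x} ∧
      ν {ω | dec ω n = x} = ENNReal.ofReal (weight t x) := by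
    intro n x
    obtain ⟨a, ha, hw⟩ := key n x
    have : {ω | dec ω n = x} = Set.pi (Finset.range n) (fun k => {a k}) := by
      ext ω
      simp only [Set.mem_ofPred_eq, ha, Set.mem_pi, Set.mem_singleton_iff, Finset.mem_coe]
    rw [this]
    refine ⟨MeasurableSet.pi (Finset.range n).countable_toSet fun _ _ => MeasurableSet.of_discrete, ?_⟩
    rw [Measure.infinitePi_pi _ (fun _ _ => MeasurableSet.of_discrete), ← hw,
      ENNReal.ofReal_prod_of_nonneg (fun k _ => f_nonneg k _)]
    refine Finset.prod_congr rfl fun k _ => ?_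
    rw [PMF.toMeasure_apply_singleton _ _ MeasurableSet.of_discrete]
    rfl
  let D : (∀ k, Option (Letters k)) → XLim := fun ω => ⟨dec ω, fun n => by
    rw [dec_succ, ins_proj]⟩
  have hD : Measurable D :=
    XLim.measurable_of_p fun n => measurable_to_countable' fun x => (hset n x).1
  refine ⟨ν.map D, Measure.isProbabilityMeasure_map hD.aemeasurable, fun n x => ?_⟩
  rw [Measure.map_apply hD (XLim.measurable_p n (measurableSet_singleton x)), ← (hset n x).2]
  rfl

/-- The probability measure `μ_t = lim μ_t^{(n)}` on `X`: its image on `X(n)` is `μ_t^{(n)}`. -/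
def ewens {t : ℝ} (ht : 0 < t) : Measure XLim := (exists_ewens ht).choose

instance {t : ℝ} (ht : 0 < t) : IsProbabilityMeasure (ewens ht) :=
  (exists_ewens ht).choose_spec.1

theorem ewens_cylinder {t : ℝ} (ht : 0 < t) {n : ℕ} (x : Pairing n) :
    ewens ht (XLim.p n ⁻¹' {x}) = ENNReal.ofReal (weight t x) :=
  (exists_ewens ht).choose_spec.2 n x


theorem XLim.exists_factor {m n : ℕ} (h : m ≤ n) :
    ∃ f : Pairing n → Pairing m, ∀ x : XLim, x.p m = f (x.p n) := by
  induction n, h using Nat.le_induction with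
  | base => exact ⟨id, fun _ => rfl⟩
  | succ n hn ih =>
    obtain ⟨f, hf⟩ := ih
    exact ⟨fun y => f (proj y), fun x => by
      rw [hf, ← x.proj_p]⟩

theorem XLim.measure_ext {μ ν : Measure XLim} [IsFiniteMeasure μ] (N : ℕ)
    (h : ∀ n, N ≤ n → ∀ x : Pairing n, μ (XLim.p n ⁻¹' {x}) = ν (XLim.p n ⁻¹' {x})) : μ = ν := by
  let C : Set (Set XLim) := {s | ∃ n, N ≤ n ∧ ∃ x : Pairing n, s = XLim.p n ⁻¹' {x}}
  have hgen : (inferInstance : MeasurableSpace XLim) = MeasurableSpace.generateFrom C := by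
    apply le_antisymm
    · have hid : @Measurable XLim XLim (MeasurableSpace.generateFrom C) _ id := by
        refine @XLim.measurable_of_p XLim (MeasurableSpace.generateFrom C) id fun n => ?_
        obtain ⟨f, hf⟩ := XLim.exists_factor (le_max_left n N)
        have h1 : @Measurable XLim (Pairing (max n N)) (MeasurableSpace.generateFrom C) _
            (XLim.p (max n N)) := by
          refine @measurable_to_countable' _ _ _ _ (MeasurableSpace.generateFrom C) _ fun x => ?_
          exact MeasurableSpace.measurableSet_generateFrom ⟨_, le_max_right _ _, x, rfl⟩
        have h2 : (fun a : XLim => (id a).p n) = f ∘ XLim.p (max n N) := funext hf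
        rw [h2]
        exact (measurable_of_countable f).comp h1
      intro s hs
      exact hid hs
    · apply MeasurableSpace.generateFrom_le
      rintro s ⟨n, -, x, rfl⟩
      exact XLim.measurable_p n (measurableSet_singleton x)
  have hpi : IsPiSystem C := by
    have key : ∀ m n, m ≤ n → N ≤ n → ∀ (x : Pairing m) (y : Pairing n),
        (XLim.p m ⁻¹' {x} ∩ XLim.p n ⁻¹' {y}).Nonempty →
        XLim.p m ⁻¹' {x} ∩ XLim.p n ⁻¹' {y} ∈ C := by
      rintro m n hmn hn x y ⟨w, hw1, hw2⟩
      refine ⟨n, hn, y, Set.inter_eq_right.2 ?_⟩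
      intro v hv
      have h1 : v.p n = w.p n := Eq.trans hv (Eq.symm hw2)
      exact (XLim.eq_of_p_eq hmn h1).trans hw1
    rintro _ ⟨m, hm, x, rfl⟩ _ ⟨n, hn, y, rfl⟩ hne
    rcases le_total m n with hmn | hmn
    · exact key m n hmn hn x y hne
    · rw [Set.inter_comm] at hne ⊢
      exact key n m hmn hm y x hne
  refine Measure.ext_of_generateFrom_of_cover_subset hgen hpi
    (T := Set.range fun x : Pairing N => XLim.p N ⁻¹' {x}) ?_ (Set.countable_range _) ?_
    (fun _ _ => measure_ne_top _ _) ?_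
  · rintro _ ⟨x, rfl⟩
    exact ⟨N, le_rfl, x, rfl⟩
  · ext w
    simp
  · rintro _ ⟨n, hn, x, rfl⟩
    exact h n hn x

theorem measurable_smul_XLim (g : S2inf) : Measurable fun x : XLim => g • x := by
  refine XLim.measurable_of_p fun m => ?_
  obtain ⟨n, hmn, hn⟩ := XLim.exists_supported g m
  obtain ⟨f, hf⟩ := XLim.exists_factor hmn
  have : (fun x : XLim => (g • x).p m) =
      (fun y => f (restr n (g : Perm ℤ) • y)) ∘ XLim.p n := by
    funext x
    rw [hf, XLim.p_smul hn]; rfl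
  rw [this]
  exact (measurable_of_countable _).comp (XLim.measurable_p n)

theorem measurable_cocycle (g : S2inf) : Measurable fun x : XLim => cocycle x g := by
  have : (fun x : XLim => cocycle x g) =
      (fun y => ((restr (level g) (g : Perm ℤ) • y).circles : ℤ) - y.circles) ∘
        XLim.p (level g) := by
    funext x
    rw [cocycle, XLim.p_smul (supported_level g)]; rfl
  rw [this]
  exact (measurable_of_countable _).comp (XLim.measurable_p _)

/-- Quasi-invariance of `μ_t`, with density `t ^ c(x; g)`. -/
theorem ewens_quasi {t : ℝ} (ht : 0 < t) (g : S2inf) :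
    ((ewens ht).withDensity fun x => ENNReal.ofReal (t ^ cocycle x g)).map (g • ·) =
      ewens ht := by
  symm
  apply XLim.measure_ext (level g)
  intro n hn y
  have hg : Supported n (g : Perm ℤ) := (supported_level g).mono hn
  set r := restr n (g : Perm ℤ) with hr
  have hpre : (fun x : XLim => g • x) ⁻¹' (XLim.p n ⁻¹' {y}) = XLim.p n ⁻¹' {r⁻¹ • y} := by
    ext x
    simp only [Set.mem_preimage, Set.mem_singleton_iff]
    rw [XLim.p_smul hg, eq_inv_smul_iff]
  have hm : MeasurableSet (XLim.p n ⁻¹' {r⁻¹ • y}) :=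
    XLim.measurable_p n (measurableSet_singleton _)
  rw [Measure.map_apply (measurable_smul_XLim g) (XLim.measurable_p n (measurableSet_singleton y)),
    hpre, withDensity_apply _ hm]
  have hconst : ∀ x ∈ XLim.p n ⁻¹' {r⁻¹ • y}, ENNReal.ofReal (t ^ cocycle x g) =
      ENNReal.ofReal (t ^ ((y.circles : ℤ) - (r⁻¹ • y).circles)) := by
    intro x hx
    have hx' : x.p n = r⁻¹ • y := hx
    rw [cocycle_eq hg, XLim.p_smul hg, hx', smul_inv_smul]
  rw [setLIntegral_congr_fun hm hconst, setLIntegral_const, ewens_cylinder, ewens_cylinder,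
    ← ENNReal.ofReal_mul (by positivity)]
  congr 1
  unfold weight
  rw [zpow_sub₀ ht.ne', zpow_natCast, zpow_natCast]
  field_simp

theorem quasiMeasurePreserving_smul {t : ℝ} (ht : 0 < t) (g : S2inf) :
    Measure.QuasiMeasurePreserving (fun x : XLim => g • x) (ewens ht) (ewens ht) := by
  refine ⟨measurable_smul_XLim g, ?_⟩
  have hd : Measurable fun x : XLim => ENNReal.ofReal (t ^ cocycle x g) :=
    ENNReal.measurable_ofReal.comp
      ((measurable_of_countable fun k : ℤ => t ^ k).comp (measurable_cocycle g))
  have h1 : ewens ht ≪ (ewens ht).withDensity fun x => ENNReal.ofReal (t ^ cocycle x g) :=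
    withDensity_absolutelyContinuous' hd.aemeasurable
      (Filter.Eventually.of_forall fun x => by
        simp only [ne_eq, ENNReal.ofReal_eq_zero, not_le]
        positivity)
  have h2 := h1.map (measurable_smul_XLim g)
  rwa [ewens_quasi] at h2

/-! ### The representation `T_{z,1/2}` -/

theorem sq_norm_pos {z : ℂ} (hz : z ≠ 0) : 0 < ‖z‖ ^ 2 := by positivity

/-- The Hilbert space `L²(X, μ_t)` with `t = |z|²`. -/
abbrev L2 {z : ℂ} (hz : z ≠ 0) : Type := Lp ℂ 2 (ewens (sq_norm_pos hz))

/-- The function `x ↦ z ^ c(x; g) f(x · g)`. -/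
def twist (z : ℂ) (g : S2inf) (f : XLim → ℂ) (x : XLim) : ℂ := z ^ cocycle x g * f (g • x)

theorem twist_congr {z : ℂ} (hz : z ≠ 0) (g : S2inf) {f f' : XLim → ℂ}
    (h : f =ᵐ[ewens (sq_norm_pos hz)] f') :
    twist z g f =ᵐ[ewens (sq_norm_pos hz)] twist z g f' := by
  filter_upwards [(quasiMeasurePreserving_smul (sq_norm_pos hz) g).ae_eq_comp h] with x hx
  unfold twist
  exact congrArg _ hx

theorem eLpNorm_twist {z : ℂ} (hz : z ≠ 0) (g : S2inf) {f : XLim → ℂ}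
    (hf : AEStronglyMeasurable f (ewens (sq_norm_pos hz))) :
    eLpNorm (twist z g f) 2 (ewens (sq_norm_pos hz)) =
      eLpNorm f 2 (ewens (sq_norm_pos hz)) := by
  have hmain : ∀ f : XLim → ℂ, StronglyMeasurable f →
      eLpNorm (twist z g f) 2 (ewens (sq_norm_pos hz)) =
        eLpNorm f 2 (ewens (sq_norm_pos hz)) := by
    intro f hf
    have hd : Measurable fun x : XLim => ENNReal.ofReal ((‖z‖ ^ 2) ^ cocycle x g) :=
      ENNReal.measurable_ofReal.comp
        ((measurable_of_countable fun k : ℤ => (‖z‖ ^ 2) ^ k).comp (measurable_cocycle g))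
    have hF : Measurable fun x => ‖f x‖ₑ ^ (2 : ℝ) := hf.measurable.enorm.pow_const _
    rw [eLpNorm_eq_lintegral_rpow_enorm_toReal (by norm_num) (by norm_num),
      eLpNorm_eq_lintegral_rpow_enorm_toReal (by norm_num) (by norm_num)]
    congr 1
    simp only [ENNReal.toReal_ofNat]
    conv_rhs => rw [← ewens_quasi (sq_norm_pos hz) g]
    rw [lintegral_map hF (measurable_smul_XLim g),
      lintegral_withDensity_eq_lintegral_mul _ hd
        (show Measurable fun x : XLim => ‖f (g • x)‖ₑ ^ (2 : ℝ) from
          hF.comp (measurable_smul_XLim g))]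
    refine lintegral_congr fun x => ?_
    simp only [twist, Pi.mul_apply]
    rw [enorm_mul, ENNReal.mul_rpow_of_nonneg _ _ (by norm_num)]
    congr 1
    rw [← ofReal_norm, norm_zpow, ENNReal.rpow_two, ← ENNReal.ofReal_pow (by positivity)]
    congr 1
    rw [← zpow_natCast, ← zpow_natCast, ← zpow_mul, ← zpow_mul, mul_comm]
  rw [eLpNorm_congr_ae (twist_congr hz g hf.ae_eq_mk), hmain _ hf.stronglyMeasurable_mk,
    eLpNorm_congr_ae hf.ae_eq_mk]

theorem memLp_twist {z : ℂ} (hz : z ≠ 0) (g : S2inf) {f : XLim → ℂ}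
    (hf : MemLp f 2 (ewens (sq_norm_pos hz))) :
    MemLp (twist z g f) 2 (ewens (sq_norm_pos hz)) := by
  refine ⟨?_, by rw [eLpNorm_twist hz g hf.1]; exact hf.2⟩
  refine AEStronglyMeasurable.mul ?_ ?_
  · exact ((measurable_of_countable fun k : ℤ => z ^ k).comp
      (measurable_cocycle g)).aestronglyMeasurable
  · exact hf.1.comp_quasiMeasurePreserving (quasiMeasurePreserving_smul _ g)

theorem twist_one (z : ℂ) (f : XLim → ℂ) : twist z 1 f = f := by
  funext x
  simp [twist, cocycle_one]

theorem twist_twist {z : ℂ} (hz : z ≠ 0) (g h : S2inf) (f : XLim → ℂ) :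
    twist z g (twist z h f) = twist z (h * g) f := by
  funext x
  simp only [twist]
  rw [cocycle_mul, mul_smul, zpow_add₀ hz]
  ring

/-- The operator `(T(g) f)(x) = z ^ c(x; g) f(x · g)` as an isometry of `L²(X, μ_t)`. -/
def opT {z : ℂ} (hz : z ≠ 0) (g : S2inf) : L2 hz →ₗᵢ[ℂ] L2 hz where
  toFun f := (memLp_twist hz g (Lp.memLp f)).toLp _
  map_add' f₁ f₂ := by
    rw [← MemLp.toLp_add]
    apply MemLp.toLp_congr
    refine (twist_congr hz g (Lp.coeFn_add f₁ f₂)).trans (Filter.Eventually.of_forall fun x => ?_)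
    simp only [twist, Pi.add_apply, mul_add]
  map_smul' c f := by
    rw [RingHom.id_apply, ← MemLp.toLp_const_smul]
    apply MemLp.toLp_congr
    refine (twist_congr hz g (Lp.coeFn_smul c f)).trans (Filter.Eventually.of_forall fun x => ?_)
    simp only [twist, Pi.smul_apply, smul_eq_mul]
    ring
  norm_map' f := by
    change ‖(memLp_twist hz g (Lp.memLp f)).toLp _‖ = ‖f‖
    rw [Lp.norm_toLp, eLpNorm_twist hz g (Lp.aestronglyMeasurable f), Lp.norm_def]

theorem coeFn_opT {z : ℂ} (hz : z ≠ 0) (g : S2inf) (f : L2 hz) :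
    opT hz g f =ᵐ[ewens (sq_norm_pos hz)] twist z g f :=
  MemLp.coeFn_toLp (memLp_twist hz g (Lp.memLp f))

theorem opT_opT {z : ℂ} (hz : z ≠ 0) (g h : S2inf) (f : L2 hz) :
    opT hz g (opT hz h f) = opT hz (h * g) f := by
  apply Lp.ext
  refine (coeFn_opT hz g _).trans ((twist_congr hz g (coeFn_opT hz h f)).trans ?_)
  rw [twist_twist hz]
  exact (coeFn_opT hz _ f).symm

theorem opT_one {z : ℂ} (hz : z ≠ 0) (f : L2 hz) : opT hz 1 f = f := by
  apply Lp.ext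
  refine (coeFn_opT hz 1 f).trans ?_
  rw [twist_one]

/-- The unitary representation `T_{z,1/2}` of `S(2∞)` in `L²(X, μ_t)`, `t = |z|²`, given by
`(T(g) f)(x) = z ^ c(x; g) f(x · g)`.  The group is `S2infᵐᵒᵖ`, since permutations acting from the
right are multiplied from left to right. -/
def repT {z : ℂ} (hz : z ≠ 0) : S2infᵐᵒᵖ →* (L2 hz ≃ₗᵢ[ℂ] L2 hz) where
  toFun g :=
    { (opT hz g.unop).toLinearMap with
      invFun := opT hz g.unop⁻¹
      left_inv := fun f => by
        change opT hz g.unop⁻¹ (opT hz g.unop f) = f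
        rw [opT_opT, mul_inv_cancel, opT_one]
      right_inv := fun f => by
        change opT hz g.unop (opT hz g.unop⁻¹ f) = f
        rw [opT_opT, inv_mul_cancel, opT_one]
      norm_map' := (opT hz g.unop).norm_map }
  map_one' := LinearIsometryEquiv.ext fun f => opT_one hz f
  map_mul' g h := LinearIsometryEquiv.ext fun f => (opT_opT hz g.unop h.unop f).symm

/-- The spherical vector of `T_{z,1/2}`: the function identically equal to `1`. -/
def oneVec {z : ℂ} (hz : z ≠ 0) : L2 hz :=
  (memLp_const (1 : ℂ) : MemLp (fun _ : XLim => (1 : ℂ)) 2 (ewens (sq_norm_pos hz))).toLp _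

/-- The vector `1` is a unit vector. -/
theorem norm_oneVec {z : ℂ} (hz : z ≠ 0) : ‖oneVec hz‖ = 1 := by
  rw [oneVec, Lp.norm_toLp, eLpNorm_const _ (by norm_num) (IsProbabilityMeasure.ne_zero _)]
  simp

theorem circles_smul {n : ℕ} {h : Perm (Letters n)} (hh : h ∈ hyperoctahedral n)
    (x : Pairing n) : (h • x).circles = x.circles := by
  have hc : ∀ i, h (flip n i) = flip n (h i) := fun i =>
    (congrArg (fun σ : Perm (Letters n) => σ i)
      (Subgroup.mem_centralizer_iff.1 hh (flip n) rfl)).symm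
  refine (Nat.card_congr (Quot.congr h fun i j => ?_)).symm
  unfold Pairing.step
  rw [smul_partner', ← hc, h.injective.eq_iff, h.injective.eq_iff]

/-- The vector `1` is invariant under `H(∞)`, the union of the groups `H(n)`. -/
theorem repT_oneVec {z : ℂ} (hz : z ≠ 0) {n : ℕ} {h : Perm (Letters n)}
    (hh : h ∈ hyperoctahedral n) :
    repT hz (MulOpposite.op (toS2inf n h)) (oneVec hz) = oneVec hz := by
  apply Lp.ext
  have h1 : oneVec hz =ᵐ[ewens (sq_norm_pos hz)] fun _ => 1 := MemLp.coeFn_toLp _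
  refine (coeFn_opT hz (toS2inf n h) (oneVec hz)).trans ((twist_congr hz _ h1).trans ?_)
  refine Filter.EventuallyEq.trans (Filter.Eventually.of_forall fun x => ?_) h1.symm
  have hs : Supported n (toS2inf n h : Perm ℤ) := supported_ofSubtype h
  rw [twist, cocycle_eq hs, XLim.p_smul hs, restr_toS2inf, circles_smul hh, sub_self, zpow_zero,
    mul_one]

/-- The spherical function `φ_z(g) = (T(g) 1, 1)` (the inner product `(ξ, η)` of the literature is
linear in `ξ`, and `inner ℂ η ξ` in Lean). -/
def sphericalFun {z : ℂ} (hz : z ≠ 0) (g : S2inf) : ℂ :=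
  inner ℂ (oneVec hz) (repT hz (MulOpposite.op g) (oneVec hz))


/-! ### Irreducible characters of symmetric groups -/

/-- The row symmetrizer: the sum of the permutations of the boxes of `μ` preserving each row. -/
def rowSymmetrizer (μ : YoungDiagram) : MonoidAlgebra ℂ (Perm μ.cells) := by
  classical
  exact ∑ σ : Perm μ.cells with ∀ c, (σ c).1.1 = c.1.1, MonoidAlgebra.of ℂ _ σ

/-- The column antisymmetrizer: the signed sum of the permutations preserving each column. -/
def colAntisymmetrizer (μ : YoungDiagram) : MonoidAlgebra ℂ (Perm μ.cells) := by
  classical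
  exact ∑ σ : Perm μ.cells with ∀ c, (σ c).1.2 = c.1.2,
    ((Perm.sign σ : ℤ) : ℂ) • MonoidAlgebra.of ℂ _ σ

/-- The Specht module `ℂ[S] · c_μ`, the left ideal generated by the Young symmetrizer `c_μ`, where
`S` is the group of permutations of the boxes of `μ`. -/
def spechtModule (μ : YoungDiagram) : Submodule ℂ (MonoidAlgebra ℂ (Perm μ.cells)) :=
  LinearMap.range (LinearMap.mulRight ℂ (rowSymmetrizer μ * colAntisymmetrizer μ))

theorem mul_mem_spechtModule {μ : YoungDiagram} (a : MonoidAlgebra ℂ (Perm μ.cells))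
    {v : MonoidAlgebra ℂ (Perm μ.cells)} (hv : v ∈ spechtModule μ) : a * v ∈ spechtModule μ := by
  obtain ⟨b, rfl⟩ := hv
  exact ⟨a * b, mul_assoc _ _ _⟩

/-- The irreducible representation attached to `μ`, by left multiplication on the Specht module. -/
def spechtRep (μ : YoungDiagram) : Representation ℂ (Perm μ.cells) (spechtModule μ) where
  toFun g := (LinearMap.mulLeft ℂ (MonoidAlgebra.of ℂ (Perm μ.cells) g)).restrict
    fun _ hv => mul_mem_spechtModule _ hv
  map_one' := LinearMap.ext fun v => Subtype.ext (by
    change MonoidAlgebra.of ℂ (Perm μ.cells) 1 * v.1 = v.1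
    rw [map_one, one_mul])
  map_mul' g h := LinearMap.ext fun v => Subtype.ext (by
    change MonoidAlgebra.of ℂ (Perm μ.cells) (g * h) * v.1 =
      MonoidAlgebra.of ℂ (Perm μ.cells) g * (MonoidAlgebra.of ℂ (Perm μ.cells) h * v.1)
    rw [map_mul, mul_assoc])

/-- The Young diagram `2μ = (2μ₁, 2μ₂, …)`, in which each box of `μ` is replaced by two boxes in the
same row. -/
def double (μ : YoungDiagram) : YoungDiagram where
  cells := (μ.cells ×ˢ Finset.range 2).image fun p => (p.1.1, 2 * p.1.2 + p.2)
  isLowerSet := by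
    rintro ⟨i, j⟩ ⟨i', j'⟩ h hm
    simp only [Finset.coe_image, Set.mem_image, Finset.mem_coe, Finset.mem_product,
      Finset.mem_range, Prod.exists, Prod.mk.injEq, YoungDiagram.mem_cells] at hm ⊢
    obtain ⟨a, b, e, ⟨hab, he⟩, rfl, rfl⟩ := hm
    obtain ⟨h1, h2⟩ := h
    simp only at h1 h2
    exact ⟨i', j' / 2, j' % 2, ⟨μ.up_left_mem h1 (by omega) hab, by omega⟩, rfl, by omega⟩

theorem card_double (μ : YoungDiagram) : (double μ).card = 2 * μ.card := by
  change ((μ.cells ×ˢ Finset.range 2).image fun p => (p.1.1, 2 * p.1.2 + p.2)).card = _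
  rw [Finset.card_image_of_injOn, Finset.card_product, Finset.card_range, mul_comm]
  rintro ⟨⟨a, b⟩, e⟩ h ⟨⟨a', b'⟩, e'⟩ h' heq
  simp only [Finset.coe_product, Set.mem_prod, Finset.mem_coe, Finset.mem_range,
    Prod.mk.injEq] at h h' heq ⊢
  omega

/-- The set of Young diagrams with `n` boxes. -/
abbrev Young (n : ℕ) : Type := {μ : YoungDiagram // μ.card = n}

theorem finite_young (n : ℕ) : Finite (Young n) := by
  have hsub : ∀ μ : Young n, μ.1.cells ⊆ Finset.range n ×ˢ Finset.range n := by
    rintro ⟨μ, hμ⟩ ⟨i, j⟩ h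
    rw [YoungDiagram.mem_cells] at h
    have h1 : (Finset.range (i + 1)).image (fun a => (a, j)) ⊆ μ.cells := by
      intro c hc
      obtain ⟨a, ha, rfl⟩ := Finset.mem_image.1 hc
      exact μ.up_left_mem (Nat.lt_succ_iff.1 (Finset.mem_range.1 ha)) le_rfl h
    have h2 : (Finset.range (j + 1)).image (fun a => (i, a)) ⊆ μ.cells := by
      intro c hc
      obtain ⟨a, ha, rfl⟩ := Finset.mem_image.1 hc
      exact μ.up_left_mem le_rfl (Nat.lt_succ_iff.1 (Finset.mem_range.1 ha)) h
    have h3 := Finset.card_le_card h1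
    have h4 := Finset.card_le_card h2
    rw [Finset.card_image_of_injective _ (fun a b hab => (Prod.mk.inj hab).1),
      Finset.card_range] at h3
    rw [Finset.card_image_of_injective _ (fun a b hab => (Prod.mk.inj hab).2),
      Finset.card_range] at h4
    have h5 : μ.cells.card = n := hμ
    simp only [Finset.mem_product, Finset.mem_range]
    omega
  refine Finite.of_injective
    (fun μ : Young n => (⟨μ.1.cells, Finset.mem_powerset.2 (hsub μ)⟩ :
      {s // s ∈ (Finset.range n ×ˢ Finset.range n).powerset})) fun μ ν h => ?_
  exact Subtype.ext (YoungDiagram.ext (Subtype.mk.inj h))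

instance (n : ℕ) : Fintype (Young n) :=
  have := finite_young n
  Fintype.ofFinite _

/-- A numbering of the boxes of `2lam` by the symbols `-n, …, -1, 1, …, n`. -/
def numbering {n : ℕ} (lam : Young n) : Letters n ≃ (double lam.1).cells :=
  Fintype.equivOfCardEq (by
    rw [card_letters, Fintype.card_coe]
    exact (by rw [card_double, lam.2] : (double lam.1).card = 2 * n).symm)

/-- The irreducible character `χ^{2λ}` of `S(2n)` (as a class function it does not depend on the
numbering). -/
def charDouble {n : ℕ} (lam : Young n) (g : Perm (Letters n)) : ℂ :=
  (spechtRep (double lam.1)).character ((numbering lam).permCongr g)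

/-- The dimension `dim 2λ` of the irreducible representation of `S(2n)` attached to `2λ`. -/
def dimDouble {n : ℕ} (lam : Young n) : ℕ := Module.finrank ℂ (spechtModule (double lam.1))

/-! ### Zonal spherical functions and the weights `M_{z,1/2}^{(n)}` -/

/-- The zonal spherical function `w^λ(g) = |H(n)|⁻¹ ∑_{h ∈ H(n)} χ^{2λ}(g h)` of the Gelfand pair
`(S(2n), H(n))`. -/
def zonal {n : ℕ} (lam : Young n) (g : Perm (Letters n)) : ℂ := by
  classical
  exact (Nat.card (hyperoctahedral n) : ℂ)⁻¹ *
    ∑ h : hyperoctahedral n, charDouble lam (g * (h : Perm (Letters n)))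

theorem exists_smul_basePairing {n : ℕ} (x : Pairing n) :
    ∃ g : Perm (Letters n), g • basePairing n = x := by
  classical
  have key : ∀ y : Pairing n,
      (Function.Involutive.toPerm y.partner y.partner_partner).cycleType =
        Multiset.replicate n 2 := by
    intro y
    set σ := Function.Involutive.toPerm y.partner y.partner_partner with hσ
    have hσ2 : σ ^ 2 = 1 := by
      ext i
      rw [pow_two, Perm.mul_apply]
      exact congrArg Subtype.val (y.partner_partner i)
    have h1 : ∀ m ∈ σ.cycleType, m = 2 := by
      intro m hm
      have h2 := Perm.two_le_of_mem_cycleType hm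
      have h3 := (Perm.dvd_of_mem_cycleType hm).trans (orderOf_dvd_of_pow_eq_one hσ2)
      exact le_antisymm (Nat.le_of_dvd (by norm_num) h3) h2
    have h4 := Multiset.eq_replicate_card.2 h1
    have h5 : σ.cycleType.sum = 2 * n := by
      rw [Perm.sum_cycleType, ← card_letters n, ← Finset.card_univ]
      congr 1
      ext i
      simp only [Perm.mem_support, Finset.mem_univ, iff_true]
      exact y.partner_ne i
    rw [h4, Multiset.sum_replicate, smul_eq_mul] at h5
    rw [h4, show σ.cycleType.card = n by omega]
  have hconj := Perm.isConj_iff_cycleType_eq.2 ((key (basePairing n)).trans (key x).symm)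
  obtain ⟨c, hc⟩ := isConj_iff.1 hconj
  refine ⟨c, Pairing.ext (funext fun i => ?_)⟩
  exact congrArg (fun τ : Perm (Letters n) => τ i) hc

/-- The function on `X(n) = H(n) \ S(2n)` induced by a function on `S(2n)` that is constant on the
cosets: its value at `x` is the value at any `g` carrying the base pairing to `x`. -/
def descend {n : ℕ} (f : Perm (Letters n) → ℂ) (x : Pairing n) : ℂ :=
  f (exists_smul_basePairing x).choose

/-- The inner product of `L²(X(n), μ₁^{(n)})`, where `μ₁^{(n)}` is the uniform distribution. -/
def innerX {n : ℕ} (f₁ f₂ : Pairing n → ℂ) : ℂ :=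
  (Fintype.card (Pairing n) : ℂ)⁻¹ * ∑ x, f₁ x * (starRingEnd ℂ) (f₂ x)

/-- The function `F_z^{(n)}(x) = ((1 · 3 ⋯ (2n-1)) / (t (t+2) ⋯ (t+2n-2)))^{1/2} z^{[x]ₙ}` on `X(n)`,
with `t = |z|²`. -/
def Fz (z : ℂ) (n : ℕ) (x : Pairing n) : ℂ :=
  (√((∏ k ∈ Finset.range n, (2 * (k : ℝ) + 1)) /
    ∏ k ∈ Finset.range n, (‖z‖ ^ 2 + 2 * (k : ℝ))) : ℝ) * z ^ x.circles

/-- The normalized zonal spherical function `(dim 2λ)^{1/2} w^λ`, as a function on `X(n)`. -/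
def zonalNormalized {n : ℕ} (lam : Young n) (x : Pairing n) : ℂ :=
  (√(dimDouble lam : ℝ) : ℝ) * descend (zonal lam) x

/-- The `z`-measure `M_{z,1/2}^{(n)}(λ) = |(F_z^{(n)}, (dim 2λ)^{1/2} w^λ)|²`. -/
def zMeasure (z : ℂ) {n : ℕ} (lam : Young n) : ℝ :=
  ‖innerX (Fz z n) (zonalNormalized lam)‖ ^ 2

end GelfandZ

end

/-! Let `e` be the average of the elements of `H(n)` in `ℂ[S(2n)]`, and let `P_μ` be the central
idempotent of the block of `ℂ[S(2n)]` generated by the Young symmetrizer of `μ`. When `μ = 2λ` the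
product `f_λ = e P_μ` does not vanish, because the elements of `H(n)` that occur in the Young
symmetrizer of a suitably numbered diagram all occur with sign `+1`. So the `f_λ` are orthogonal
nonzero idempotents in the algebra of `H(n)`-biinvariant functions. The dimension of this algebra is
at most the number of diagrams with `n` boxes, since a pair of fixed-point-free involutions is
determined up to simultaneous conjugation by the cycle lengths of their product; hence the `f_λ`
form a basis. As functions on `S(2n)`, `f_λ` and `w^λ` are proportional, with ratio
`dim 2λ / (2n)!`, so the orthogonality of the idempotents gives the expansion of an
`H(n)`-invariant function on `X(n)` in the functions `(dim 2λ)^{1/2} w^λ`. It is applied to `F_z`,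
because `φ_z(g)` is the inner product of `x ↦ F_z(x · g)` with `F_z`. -/

noncomputable section

namespace GelfandZ

open MonoidAlgebra (single coeff_single coeff_single_mul_apply coeff_mul_single_apply coeff_sum
  coeff_smul single_mul_single smul_single')

/-! ### Minimal idempotents of a group algebra -/

section MinimalIdempotent

theorem coeff_mul_one_comm {k G : Type*} [CommSemiring k] [Group G] (x y : MonoidAlgebra k G) :
    (x * y).coeff 1 = (y * x).coeff 1 := by
  classical
  induction x using MonoidAlgebra.induction_linear with
  | zero => simp
  | add x x' hx hx' => simp [add_mul, mul_add, hx, hx']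
  | single u r => simp [coeff_single_mul_apply, coeff_mul_single_apply, mul_comm]

theorem coeff_one_conj {k G : Type*} [Semiring k] [Group G]
    (x : MonoidAlgebra k G) (u : G) :
    (single u 1 * (x * single u⁻¹ 1)).coeff 1 = x.coeff 1 := by
  simp [coeff_single_mul_apply, coeff_mul_single_apply]

/-- A nonzero idempotent `e` with `e A e = k e`, so that the left ideal `A e` is an absolutely
simple module when `A` is semisimple. -/
structure IsMinimalIdempotent (k : Type*) {A : Type*} [CommSemiring k] [Semiring A] [Algebra k A]
    (e : A) : Prop where
  idem : IsIdempotentElem e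
  ne_zero : e ≠ 0
  sandwich : ∀ x, ∃ r : k, e * x * e = r • e

namespace IsMinimalIdempotent

variable {k G : Type*} [Field k] [Group G] {e f : MonoidAlgebra k G}

theorem coeff_one_ne_zero (he : IsMinimalIdempotent k e) : e.coeff 1 ≠ 0 := by
  intro h1
  refine he.ne_zero (MonoidAlgebra.ext (Finsupp.ext fun g => ?_))
  obtain ⟨r, hr⟩ := he.sandwich (single g⁻¹ 1)
  calc e.coeff g = (e * e * single g⁻¹ 1).coeff 1 := by
        rw [he.idem.eq, coeff_mul_single_apply, inv_inv, one_mul, mul_one]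
    _ = (e * single g⁻¹ 1 * e).coeff 1 := by rw [mul_assoc, coeff_mul_one_comm]
    _ = 0 := by rw [hr, coeff_smul, Finsupp.smul_apply, h1, smul_zero]

theorem mul_mul_self (he : IsMinimalIdempotent k e) (x : MonoidAlgebra k G) :
    e * x * e = ((e * x).coeff 1 / e.coeff 1) • e := by
  obtain ⟨r, hr⟩ := he.sandwich x
  have h : (e * x).coeff 1 = r * e.coeff 1 := by
    calc (e * x).coeff 1 = (e * x * e).coeff 1 := by
          rw [coeff_mul_one_comm (e * x), ← mul_assoc, he.idem.eq]
      _ = r * e.coeff 1 := by rw [hr, coeff_smul, Finsupp.smul_apply, smul_eq_mul]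
  rw [hr, h, mul_div_cancel_right₀ _ he.coeff_one_ne_zero]

theorem conj (he : IsMinimalIdempotent k e) (u : G) :
    IsMinimalIdempotent k (single u 1 * (e * single u⁻¹ 1)) := by
  have hu : (single u⁻¹ 1 * single u 1 : MonoidAlgebra k G) = 1 := by
    rw [single_mul_single, inv_mul_cancel, one_mul, MonoidAlgebra.one_def]
  have hmul (x : MonoidAlgebra k G) :
      single u 1 * (e * single u⁻¹ 1) * x * (single u 1 * (e * single u⁻¹ 1)) =
        single u 1 * (e * (single u⁻¹ 1 * x * single u 1) * e * single u⁻¹ 1) := by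
    simp only [mul_assoc]
  refine ⟨?_, fun h => he.coeff_one_ne_zero ?_, fun x => ?_⟩
  · have h := hmul 1
    rwa [mul_one, mul_one, hu, mul_one, he.idem.eq] at h
  · rw [← coeff_one_conj, h, MonoidAlgebra.coeff_zero, Finsupp.zero_apply]
  · obtain ⟨r, hr⟩ := he.sandwich (single u⁻¹ 1 * x * single u 1)
    exact ⟨r, by rw [hmul, hr, smul_mul_assoc, mul_smul_comm]⟩

theorem coeff_one_eq_of_mul_mul_ne_zero (he : IsMinimalIdempotent k e)
    (hf : IsMinimalIdempotent k f) (h : f * e * f ≠ 0) : e.coeff 1 = f.coeff 1 := by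
  have hfe := hf.mul_mul_self e
  have hef := he.mul_mul_self f
  set s := (f * e).coeff 1 / f.coeff 1 with hs
  set r := (e * f).coeff 1 / e.coeff 1 with hr
  have hsr : (s - r) • (f * e * f) = 0 := by
    rw [sub_smul, sub_eq_zero]
    calc s • (f * e * f) = f * e * f * e * f := by
          simp only [hfe, smul_mul_assoc]
      _ = f * (e * f * e) * f := by simp only [mul_assoc]
      _ = r • (f * e * f) := by rw [hef, mul_smul_comm, smul_mul_assoc]
  have hsr' : s = r := sub_eq_zero.1 ((smul_eq_zero.1 hsr).resolve_right h)
  have hs0 : (f * e).coeff 1 ≠ 0 := fun h0 => h (by rw [hfe, hs, h0, zero_div, zero_smul])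
  rw [hs, hr, coeff_mul_one_comm e f, div_eq_div_iff hf.coeff_one_ne_zero he.coeff_one_ne_zero]
    at hsr'
  exact mul_left_cancel₀ hs0 hsr'

end IsMinimalIdempotent

end MinimalIdempotent

section ConjSum

theorem sum_single_coeff {k G : Type*} [Semiring k] [Fintype G] (x : MonoidAlgebra k G) :
    ∑ u, single u (x.coeff u) = x := by
  classical
  exact MonoidAlgebra.ext (Finsupp.ext fun g => by simp)

variable {k G : Type*} [CommSemiring k] [Group G] [Fintype G]

theorem coeff_mul_eq_sum (x y : MonoidAlgebra k G) (g : G) :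
    (x * y).coeff g = ∑ u, x.coeff (g * u) * y.coeff u⁻¹ := by
  conv_lhs => rw [← sum_single_coeff x]
  rw [Finset.sum_mul, coeff_sum, Finsupp.finsetSum_apply]
  refine (Fintype.sum_equiv (Equiv.mulLeft g) _ _ fun u => ?_).symm
  rw [Equiv.coe_mulLeft, coeff_single_mul_apply, mul_inv_rev, inv_mul_cancel_right]

/-- The sum `∑ u, u c u⁻¹` of the conjugates of an element of a group algebra. -/
def conjSum : MonoidAlgebra k G →ₗ[k] MonoidAlgebra k G :=
  ∑ u : G, LinearMap.mulLeft k (single u 1) ∘ₗ LinearMap.mulRight k (single u⁻¹ 1)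

theorem conjSum_apply (c : MonoidAlgebra k G) :
    conjSum c = ∑ u : G, single u 1 * (c * single u⁻¹ 1) := by
  simp [conjSum]

theorem coeff_conjSum (c : MonoidAlgebra k G) (g : G) :
    (conjSum c).coeff g = ∑ u, c.coeff (u⁻¹ * g * u) := by
  simp [conjSum_apply, coeff_single_mul_apply, coeff_mul_single_apply, coeff_sum]

theorem coeff_conjSum_one (c : MonoidAlgebra k G) :
    (conjSum c).coeff 1 = Fintype.card G * c.coeff 1 := by
  simp [coeff_conjSum]

theorem coeff_conjSum_conj (c : MonoidAlgebra k G) (g v : G) :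
    (conjSum c).coeff (v * g * v⁻¹) = (conjSum c).coeff g := by
  rw [coeff_conjSum, coeff_conjSum]
  exact (Fintype.sum_equiv (Equiv.mulLeft v) _ _ fun u => by simp [mul_assoc]).symm

theorem commute_conjSum (c x : MonoidAlgebra k G) : Commute (conjSum c) x := by
  refine MonoidAlgebra.ext (Finsupp.ext fun g => ?_)
  rw [coeff_mul_eq_sum, coeff_mul_eq_sum]
  refine Fintype.sum_equiv ((Equiv.inv G).trans (Equiv.mulLeft g⁻¹)) _ _ fun u => ?_
  rw [mul_comm, ← coeff_conjSum_conj c (g * u) g⁻¹]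
  simp

theorem mul_conjSum_of_commute {a : MonoidAlgebra k G} (ha : ∀ x, Commute a x)
    (c : MonoidAlgebra k G) : a * conjSum c = conjSum (a * c) := by
  simp only [conjSum_apply, Finset.mul_sum, mul_assoc, (ha _).left_comm]

end ConjSum

section LeftIdeal

theorem trace_eq_sum_coeff {k G : Type*} [CommRing k] [Fintype G]
    (f : MonoidAlgebra k G →ₗ[k] MonoidAlgebra k G) :
    LinearMap.trace k _ f = ∑ u, (f (single u 1)).coeff u := by
  classical
  rw [LinearMap.trace_eq_matrix_trace k (MonoidAlgebra.basis G k), Matrix.trace]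
  refine Finset.sum_congr rfl fun u _ => ?_
  rw [Matrix.diag_apply, LinearMap.toMatrix_apply, MonoidAlgebra.basis_apply]
  rfl

variable {k G : Type*} [CommRing k] [IsDomain k] [IsPrincipalIdealRing k] [Group G] [Fintype G]
  {e : MonoidAlgebra k G} {p : Submodule k (MonoidAlgebra k G)}

/- For an idempotent `e`, `x ↦ g x e` has image in the left ideal generated by `e` and agrees there
with left multiplication by `g`, so the two have the same trace. -/
theorem trace_mulLeft_restrict_leftIdeal (he : IsIdempotentElem e)
    (hp : ∀ x, x ∈ p ↔ x * e = x) (g : G)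
    (hg : ∀ x ∈ p, LinearMap.mulLeft k (single g 1) x ∈ p) :
    LinearMap.trace k p ((LinearMap.mulLeft k (single g 1)).restrict hg) =
      (conjSum e).coeff g⁻¹ := by
  let F : MonoidAlgebra k G →ₗ[k] MonoidAlgebra k G :=
    LinearMap.mulRight k e ∘ₗ LinearMap.mulLeft k (single g 1)
  have hF : ∀ x, F x ∈ p := fun x => (hp _).2 (by simp [F, mul_assoc, he.eq])
  have h : (LinearMap.mulLeft k (single g 1)).restrict hg = F.restrict fun x _ => hF x :=
    LinearMap.ext fun x => Subtype.ext (by simp [F, mul_assoc, (hp _).1 x.2])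
  rw [h, LinearMap.trace_restrict_eq_of_forall_mem p F hF, trace_eq_sum_coeff, coeff_conjSum]
  simp [F, coeff_single_mul_apply, mul_assoc]

theorem finrank_leftIdeal (he : IsIdempotentElem e) (hp : ∀ x, x ∈ p ↔ x * e = x) :
    (Module.finrank k p : k) = Fintype.card G * e.coeff 1 := by
  have h1 : LinearMap.mulLeft k (single (1 : G) (1 : k)) = LinearMap.id :=
    LinearMap.ext fun x => by
      rw [← MonoidAlgebra.one_def, LinearMap.mulLeft_apply, one_mul, LinearMap.id_apply]
  have h := trace_mulLeft_restrict_leftIdeal he hp 1 fun x hx => by rwa [h1]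
  rw [inv_one, coeff_conjSum_one] at h
  rw [← h, ← LinearMap.trace_id]
  exact congrArg _ (LinearMap.ext fun x => Subtype.ext (by simp [h1]))

end LeftIdeal

section CentralIdempotent

variable {k G : Type*} [Field k] [Group G] [Fintype G]

/-- The central idempotent `P = e(1) ∑ u, u e u⁻¹` of the block of a minimal idempotent `e`. -/
def centralIdempotent (e : MonoidAlgebra k G) : MonoidAlgebra k G := e.coeff 1 • conjSum e

theorem commute_centralIdempotent (e x : MonoidAlgebra k G) :
    Commute (centralIdempotent e) x :=
  (commute_conjSum e x).smul_left _

theorem centralIdempotent_mul_centralIdempotent_eq_zero {e f : MonoidAlgebra k G}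
    (h : ∀ x, e * x * f = 0) : centralIdempotent e * centralIdempotent f = 0 := by
  have hef : conjSum e * f = 0 := by
    rw [conjSum_apply, Finset.sum_mul]
    exact Finset.sum_eq_zero fun u _ => by rw [mul_assoc, h, mul_zero]
  rw [centralIdempotent, centralIdempotent, smul_mul_smul_comm,
    mul_conjSum_of_commute (commute_conjSum e), hef, map_zero, smul_zero]

namespace IsMinimalIdempotent

variable {e f : MonoidAlgebra k G}

theorem centralIdempotent_mul (he : IsMinimalIdempotent k e) : centralIdempotent e * e = e := by
  have h (u : G) : single u 1 * (e * single u⁻¹ 1) * e =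
      (e.coeff 1)⁻¹ • (single u (e.coeff u) * e) := by
    rw [mul_assoc, he.mul_mul_self, coeff_mul_single_apply, mul_smul_comm, inv_inv, one_mul,
      mul_one, ← mul_one (e.coeff u), ← smul_single', smul_mul_assoc, smul_smul, mul_one,
      inv_mul_eq_div]
  rw [centralIdempotent, smul_mul_assoc, conjSum_apply, Finset.sum_mul,
    Finset.sum_congr rfl fun u _ => h u, ← Finset.smul_sum, ← Finset.sum_mul, sum_single_coeff,
    he.idem.eq, smul_inv_smul₀ he.coeff_one_ne_zero]

theorem isIdempotentElem_centralIdempotent (he : IsMinimalIdempotent k e) :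
    IsIdempotentElem (centralIdempotent e) := by
  have h := mul_conjSum_of_commute (commute_centralIdempotent e) e
  rw [he.centralIdempotent_mul] at h
  rw [IsIdempotentElem]
  nth_rw 2 [centralIdempotent]
  rw [mul_smul_comm, h, centralIdempotent]

theorem coeff_one_eq_of_centralIdempotent_mul (he : IsMinimalIdempotent k e)
    (hf : IsMinimalIdempotent k f) (h : centralIdempotent e * f = f) :
    e.coeff 1 = f.coeff 1 := by
  have hsum : ∑ u : G, f * (single u 1 * (e * single u⁻¹ 1)) * f ≠ 0 := by
    rw [← Finset.sum_mul, ← Finset.mul_sum, ← conjSum_apply]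
    intro h0
    refine hf.ne_zero ?_
    rw [← hf.idem.eq]
    nth_rw 2 [← h]
    rw [centralIdempotent, smul_mul_assoc, mul_smul_comm, ← mul_assoc, h0, smul_zero]
  obtain ⟨u, -, hu⟩ := Finset.exists_ne_zero_of_sum_ne_zero hsum
  rw [← (he.conj u).coeff_one_eq_of_mul_mul_ne_zero hf hu, coeff_one_conj]

end IsMinimalIdempotent

end CentralIdempotent

section NormalizedIdempotent

variable {k G : Type*} [Field k] [Group G]

/-- The multiple of `c` that is idempotent, for an element `c` with `c(1) = 1` and `c A c = k c`. -/
def normalizedIdempotent (c : MonoidAlgebra k G) : MonoidAlgebra k G := ((c * c).coeff 1)⁻¹ • c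

theorem mul_self_eq_smul {k G : Type*} [CommSemiring k] [Group G]
    {c : MonoidAlgebra k G} (h1 : c.coeff 1 = 1) (hc : ∀ x, ∃ r : k, c * x * c = r • c) :
    c * c = (c * c).coeff 1 • c := by
  obtain ⟨r, hr⟩ := hc 1
  rw [mul_one] at hr
  simp [hr, h1]

variable [CharZero k] [Finite G] {c : MonoidAlgebra k G}

/- If `c² = 0`, right multiplication by `c` is nilpotent; but its trace is `|G|`. -/
theorem coeff_mul_self_one_ne_zero (h1 : c.coeff 1 = 1)
    (hc : ∀ x, ∃ r : k, c * x * c = r • c) : (c * c).coeff 1 ≠ 0 := by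
  intro h0
  have := Fintype.ofFinite G
  have hcc : c * c = 0 := by rw [mul_self_eq_smul h1 hc, h0, zero_smul]
  have hnil : IsNilpotent (LinearMap.mulRight k c) := ⟨2, LinearMap.ext fun x => by
    simp [sq, mul_assoc, hcc]⟩
  have htr : LinearMap.trace k _ (LinearMap.mulRight k c) = Fintype.card G := by
    simp [trace_eq_sum_coeff, coeff_single_mul_apply, h1]
  rw [(LinearMap.isNilpotent_trace_of_isNilpotent hnil).eq_zero] at htr
  exact Fintype.card_ne_zero (Nat.cast_eq_zero.1 htr.symm)

theorem isMinimalIdempotent_normalizedIdempotent (h1 : c.coeff 1 = 1)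
    (hc : ∀ x, ∃ r : k, c * x * c = r • c) : IsMinimalIdempotent k (normalizedIdempotent c) := by
  have hr := coeff_mul_self_one_ne_zero h1 hc
  refine ⟨?_, smul_ne_zero (inv_ne_zero hr) fun h => ?_, fun x => ?_⟩
  · rw [IsIdempotentElem, normalizedIdempotent, smul_mul_smul_comm]
    nth_rw 3 [mul_self_eq_smul h1 hc]
    rw [smul_smul, inv_mul_cancel_right₀ hr]
  · simp [h] at h1
  · obtain ⟨s, hs⟩ := hc x
    exact ⟨((c * c).coeff 1)⁻¹ * s, by
      rw [normalizedIdempotent, smul_mul_assoc, smul_mul_smul_comm, hs, smul_smul, smul_smul]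
      ring_nf⟩

end NormalizedIdempotent

/-! ### Tableaux and Young symmetrizers -/

section Tableaux

variable {α : Type*} {μ ν : YoungDiagram}

/-- The row of an entry of a tableau, where a tableau of shape `μ` is encoded as a bijection from
its set of entries to the boxes of `μ`. -/
def rowOf (T : α ≃ μ.cells) (i : α) : ℕ := (T i).1.1

/-- The column of an entry of a tableau. -/
def colOf (T : α ≃ μ.cells) (i : α) : ℕ := (T i).1.2

theorem injective_rowOf_colOf (T : α ≃ μ.cells) :
    Function.Injective fun i => (rowOf T i, colOf T i) :=
  Subtype.val_injective.comp T.injective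

theorem rowOf_colOf_mem (T : α ≃ μ.cells) (i : α) : (rowOf T i, colOf T i) ∈ μ :=
  (YoungDiagram.mem_cells _).1 (T i).2

theorem exists_rowOf_colOf (T : α ≃ μ.cells) {a b : ℕ} (h : (a, b) ∈ μ) :
    ∃ i, rowOf T i = a ∧ colOf T i = b :=
  ⟨T.symm ⟨(a, b), (YoungDiagram.mem_cells _).2 h⟩, by simp [rowOf], by simp [colOf]⟩

theorem eq_of_sum_rowLen_eq
    (h : ∀ m, ∑ i ∈ Finset.range m, μ.rowLen i = ∑ i ∈ Finset.range m, ν.rowLen i) : μ = ν := by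
  have hrow (i : ℕ) : μ.rowLen i = ν.rowLen i := by
    simpa [Finset.sum_range_succ, h i] using h (i + 1)
  refine YoungDiagram.ext (Finset.ext fun ⟨a, b⟩ => ?_)
  rw [YoungDiagram.mem_cells, YoungDiagram.mem_cells, YoungDiagram.mem_iff_lt_rowLen,
    YoungDiagram.mem_iff_lt_rowLen, hrow]

section Card

variable [Fintype α]

/- The left side is at most `m`, and it is at most the number of entries in column `j` of `T'`; the
right side is the minimum of the two. -/
theorem card_rowOf_lt_colOf_eq_le (T : α ≃ μ.cells) (T' : α ≃ ν.cells)
    (h : Function.Injective fun i => (rowOf T i, colOf T' i)) (m j : ℕ) :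
    ({i | rowOf T i < m ∧ colOf T' i = j} : Finset α).card ≤
      ({i | rowOf T' i < m ∧ colOf T' i = j} : Finset α).card := by
  classical
  by_cases hm : ∃ i, colOf T' i = j ∧ m ≤ rowOf T' i
  · obtain ⟨i₀, hcol, hrow⟩ := hm
    calc _ ≤ (Finset.range m).card := by
          refine Finset.card_le_card_of_injOn (rowOf T) (fun i hi => ?_) fun i hi i' hi' he => ?_
          · simpa using (Finset.mem_filter.1 hi).2.1
          · exact h (Prod.ext he
              ((Finset.mem_filter.1 hi).2.2.trans (Finset.mem_filter.1 hi').2.2.symm))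
      _ ≤ (Finset.image (rowOf T') {i | rowOf T' i < m ∧ colOf T' i = j}).card := by
          refine Finset.card_le_card fun a ha => ?_
          rw [Finset.mem_range] at ha
          obtain ⟨i, hi, hi'⟩ := exists_rowOf_colOf T'
            (ν.up_left_mem (ha.le.trans hrow) hcol.ge (rowOf_colOf_mem T' i₀))
          exact Finset.mem_image.2 ⟨i, by simp [hi, hi', ha], hi⟩
      _ ≤ _ := Finset.card_image_le
  · push Not at hm
    refine Finset.card_le_card fun i hi => ?_
    have hi' := (Finset.mem_filter.1 hi).2
    simp [hi'.2, hm i hi'.2]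

theorem card_rowOf_lt_eq_sum_card (T : α ≃ μ.cells) (T' : α ≃ ν.cells) (m : ℕ) :
    ({i | rowOf T i < m} : Finset α).card = ∑ j ∈ Finset.univ.image (colOf T'),
      ({i | rowOf T i < m ∧ colOf T' i = j} : Finset α).card := by
  rw [Finset.card_eq_sum_card_fiberwise (f := colOf T') (t := Finset.univ.image (colOf T'))
    fun i _ => by simp]
  exact Finset.sum_congr rfl fun j _ => by rw [Finset.filter_filter]

theorem card_rowOf_lt (T : α ≃ μ.cells) (m : ℕ) :
    ({i | rowOf T i < m} : Finset α).card = ∑ i ∈ Finset.range m, μ.rowLen i := by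
  rw [Finset.card_eq_sum_card_fiberwise (f := rowOf T) (t := Finset.range m)
    fun i hi => by simpa using hi]
  refine Finset.sum_congr rfl fun r hr => ?_
  rw [Finset.filter_filter, YoungDiagram.rowLen_eq_card]
  refine Finset.card_bij (fun i _ => (T i).1) (fun i hi => ?_)
    (fun i _ j _ he => T.injective (Subtype.ext he)) fun b hbr => ?_
  · exact YoungDiagram.mem_row_iff.2 ⟨rowOf_colOf_mem T i, (Finset.mem_filter.1 hi).2.2⟩
  · obtain ⟨hb, rfl⟩ := YoungDiagram.mem_row_iff.1 hbr
    obtain ⟨i, hi, hi'⟩ := exists_rowOf_colOf T hb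
    exact ⟨i, by simpa [hi] using hr, Prod.ext hi hi'⟩

theorem card_rowOf_lt_colOf_eq (T T' : α ≃ μ.cells)
    (h : Function.Injective fun i => (rowOf T i, colOf T' i)) (m j : ℕ) :
    ({i | rowOf T i < m ∧ colOf T' i = j} : Finset α).card =
      ({i | rowOf T' i < m ∧ colOf T' i = j} : Finset α).card := by
  by_cases hj : j ∈ Finset.univ.image (colOf T')
  · refine (Finset.sum_eq_sum_iff_of_le fun j _ => card_rowOf_lt_colOf_eq_le T T' h m j).1 ?_ j hj
    rw [← card_rowOf_lt_eq_sum_card, ← card_rowOf_lt_eq_sum_card, card_rowOf_lt, card_rowOf_lt]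
  · have hj' (i : α) : colOf T' i ≠ j := fun hi => hj (by simp [← hi])
    simp [hj']

end Card

variable [Finite α]

theorem sum_rowLen_le_sum_rowLen (T : α ≃ μ.cells) (T' : α ≃ ν.cells)
    (h : Function.Injective fun i => (rowOf T i, colOf T' i)) (m : ℕ) :
    ∑ i ∈ Finset.range m, μ.rowLen i ≤ ∑ i ∈ Finset.range m, ν.rowLen i := by
  have := Fintype.ofFinite α
  rw [← card_rowOf_lt T, ← card_rowOf_lt T', card_rowOf_lt_eq_sum_card T T',
    card_rowOf_lt_eq_sum_card T' T']
  exact Finset.sum_le_sum fun j _ => card_rowOf_lt_colOf_eq_le T T' h m j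

theorem not_injective_rowOf_colOf_of_ne (T : α ≃ μ.cells) (T' : α ≃ ν.cells) (hne : μ ≠ ν) :
    (∀ g : Perm α, ¬ Function.Injective fun i => (rowOf T i, colOf T' (g i))) ∨
      ∀ g : Perm α, ¬ Function.Injective fun i => (rowOf T' i, colOf T (g i)) := by
  by_contra! hcon
  obtain ⟨⟨g, hg⟩, ⟨g', hg'⟩⟩ := hcon
  exact hne (eq_of_sum_rowLen_eq fun m => le_antisymm
    (sum_rowLen_le_sum_rowLen T (g.trans T') hg m) (sum_rowLen_le_sum_rowLen T' (g'.trans T) hg' m))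

theorem rowOf_colOf_mem_of_injective (T T' : α ≃ μ.cells)
    (h : Function.Injective fun i => (rowOf T i, colOf T' i)) (i : α) :
    (rowOf T i, colOf T' i) ∈ μ := by
  have := Fintype.ofFinite α
  by_contra hi
  have hT' : ({k | rowOf T' k < rowOf T i + 1 ∧ colOf T' k = colOf T' i} : Finset α) =
      ({k | rowOf T' k < rowOf T i ∧ colOf T' k = colOf T' i} : Finset α) := by
    refine Finset.filter_congr fun k _ => and_congr_left fun hk => ?_
    rw [Nat.lt_succ_iff_lt_or_eq, or_iff_left]
    exact fun hrow => hi (hrow ▸ hk ▸ rowOf_colOf_mem T' k)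
  have hT : ({k | rowOf T k < rowOf T i ∧ colOf T' k = colOf T' i} : Finset α) =
      ({k | rowOf T k < rowOf T i + 1 ∧ colOf T' k = colOf T' i} : Finset α) := by
    refine Finset.eq_of_subset_of_card_le
      (Finset.monotone_filter_right _ fun k _ hk => ⟨hk.1.trans (Nat.lt_succ_self _), hk.2⟩) ?_
    rw [card_rowOf_lt_colOf_eq T T' h, card_rowOf_lt_colOf_eq T T' h, hT']
  have hmem : i ∈ ({k | rowOf T k < rowOf T i ∧ colOf T' k = colOf T' i} : Finset α) := by
    simp [hT]
  exact lt_irrefl _ (Finset.mem_filter.1 hmem).2.1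

theorem exists_row_perm (T : α ≃ μ.cells) (g : Perm α)
    (h : Function.Injective fun i => (rowOf T i, colOf T (g i))) :
    ∃ s : Perm α, (∀ i, rowOf T (s i) = rowOf T i) ∧ ∀ i, colOf T (s i) = colOf T (g i) := by
  have hmem := rowOf_colOf_mem_of_injective T (g.trans T) h
  let f (i : α) : α := T.symm ⟨(rowOf T i, colOf T (g i)), (YoungDiagram.mem_cells _).2 (hmem i)⟩
  have hf : Function.Injective f := fun i j hij =>
    h (Subtype.mk.inj (T.symm.injective hij))
  exact ⟨Equiv.ofBijective f (Finite.injective_iff_bijective.1 hf), fun i => by simp [rowOf, f],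
    fun i => by simp [colOf, f]⟩

end Tableaux

theorem mul_mul_mem_of_single {k G : Type*} [CommSemiring k] [Group G]
    {p : Submodule k (MonoidAlgebra k G)} {a b : MonoidAlgebra k G}
    (h : ∀ g, a * single g 1 * b ∈ p) (x : MonoidAlgebra k G) : a * x * b ∈ p := by
  induction x using MonoidAlgebra.induction_linear with
  | zero => simp
  | add x y hx hy => simpa [mul_add, add_mul] using p.add_mem hx hy
  | single g r =>
    rw [← mul_one r, ← smul_single', mul_smul_comm, smul_mul_assoc]
    exact p.smul_mem r (h g)

section Stabilizers

variable (k : Type*) {α β γ : Type*} [Fintype α] [DecidableEq α] [DecidableEq β] [DecidableEq γ]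

/-- The sum of the permutations preserving a labelling `ρ`, for instance by the rows of a
tableau. -/
def stabSum [Semiring k] (ρ : α → β) : MonoidAlgebra k (Perm α) :=
  ∑ σ : Perm α with ∀ i, ρ (σ i) = ρ i, single σ 1

/-- The signed sum of the permutations preserving a labelling `κ`, for instance by the columns of a
tableau. -/
def stabAlt [Ring k] (κ : α → γ) : MonoidAlgebra k (Perm α) :=
  ∑ σ : Perm α with ∀ i, κ (σ i) = κ i, single σ ((Perm.sign σ : ℤ) : k)

variable {k}

theorem stabSum_mul_single [Semiring k] {ρ : α → β} {s : Perm α} (hs : ∀ i, ρ (s i) = ρ i) :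
    stabSum k ρ * single s 1 = stabSum k ρ := by
  rw [stabSum, Finset.sum_mul]
  refine Finset.sum_equiv (Equiv.mulRight s) (fun σ => ?_) fun σ _ => by
    rw [single_mul_single, mul_one, Equiv.coe_mulRight]
  simp only [Finset.mem_filter, Finset.mem_univ, true_and, Equiv.coe_mulRight, Perm.mul_apply]
  refine ⟨fun h i => by rw [h, hs], fun h i => ?_⟩
  have hi := h (s.symm i)
  rwa [← hs (s.symm i), apply_symm_apply] at hi

theorem single_mul_stabAlt [CommRing k] {κ : α → γ} {s : Perm α} (hs : ∀ i, κ (s i) = κ i) :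
    single s 1 * stabAlt k κ = ((Perm.sign s : ℤ) : k) • stabAlt k κ := by
  rw [stabAlt, Finset.mul_sum, Finset.smul_sum]
  refine Finset.sum_equiv (Equiv.mulLeft s) (fun σ => ?_) fun σ _ => ?_
  · simp only [Finset.mem_filter, Finset.mem_univ, true_and, Equiv.coe_mulLeft, Perm.mul_apply, hs]
  · rw [Equiv.coe_mulLeft, single_mul_single, one_mul, smul_single', map_mul, Units.val_mul,
      ← Int.cast_mul, ← mul_assoc, ← Units.val_mul, Int.units_mul_self, Units.val_one, one_mul]

theorem apply_swap_eq_self {α β : Type*} [DecidableEq α] {ρ : α → β} {i j : α} (h : ρ i = ρ j)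
    (a : α) : ρ (swap i j a) = ρ a := by
  rw [swap_apply_def]
  split_ifs with hi hj
  · rw [hi, h]
  · rw [hj, h]
  · rfl

/- A transposition of two entries that share a `ρ`-label and whose `g⁻¹`-preimages share a `κ`-label
is absorbed on the left with sign `1` and on the right with sign `-1`. -/
theorem stabSum_mul_single_mul_stabAlt_eq_zero [CommRing k] [IsAddTorsionFree k]
    {ρ : α → β} {κ : α → γ} (g : Perm α)
    (h : ¬ Function.Injective fun i => (ρ i, κ (g⁻¹ i))) :
    stabSum k ρ * single g 1 * stabAlt k κ = 0 := by
  obtain ⟨i, j, hρκ, hij⟩ := Function.not_injective_iff.1 h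
  obtain ⟨hρ, hκ⟩ := Prod.mk.inj hρκ
  have hswap : swap i j * g = g * swap (g⁻¹ i) (g⁻¹ j) := by
    rw [mul_swap_eq_swap_mul]; simp
  have hneg : stabSum k ρ * single g 1 * stabAlt k κ =
      -(stabSum k ρ * single g 1 * stabAlt k κ) := by
    calc stabSum k ρ * single g 1 * stabAlt k κ
        = stabSum k ρ * single (swap i j * g) 1 * stabAlt k κ := by
          rw [← mul_one (1 : k), ← single_mul_single, ← mul_assoc,
            stabSum_mul_single (apply_swap_eq_self hρ), mul_one]
      _ = stabSum k ρ * single g 1 * (single (swap (g⁻¹ i) (g⁻¹ j)) 1 * stabAlt k κ) := by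
          rw [hswap, ← mul_one (1 : k), ← single_mul_single, mul_one]
          simp only [mul_assoc]
      _ = -(stabSum k ρ * single g 1 * stabAlt k κ) := by
          rw [single_mul_stabAlt (apply_swap_eq_self hκ), Perm.sign_swap (g⁻¹.injective.ne hij)]
          simp
  exact MonoidAlgebra.ext (Finsupp.ext fun σ => self_eq_neg.1 (by
    simpa using congrArg (fun x => x.coeff σ) hneg))

end Stabilizers

section YoungSymmetrizer

variable (k : Type*) {α : Type*} [Fintype α] [DecidableEq α] {μ ν : YoungDiagram}

/-- The Young symmetrizer of a tableau: row symmetrizer times column antisymmetrizer. -/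
def youngSymmetrizer [Ring k] (T : α ≃ μ.cells) : MonoidAlgebra k (Perm α) :=
  stabSum k (rowOf T) * stabAlt k (colOf T)

variable {k}

theorem coeff_youngSymmetrizer [CommRing k] (T : α ≃ μ.cells) (g : Perm α) :
    (youngSymmetrizer k T).coeff g =
      ∑ s : Perm α with ∀ i, rowOf T (s i) = rowOf T i,
        if ∀ i, colOf T ((s⁻¹ * g) i) = colOf T i then ((Perm.sign (s⁻¹ * g) : ℤ) : k) else 0 := by
  rw [youngSymmetrizer, stabSum, Finset.sum_mul, coeff_sum, Finsupp.finsetSum_apply]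
  refine Finset.sum_congr rfl fun s _ => ?_
  rw [coeff_single_mul_apply, one_mul, stabAlt, coeff_sum, Finsupp.finsetSum_apply]
  simp only [coeff_single, Finsupp.single_apply]
  rw [Finset.sum_ite_eq']
  simp

theorem coeff_one_youngSymmetrizer [CommRing k] (T : α ≃ μ.cells) :
    (youngSymmetrizer k T).coeff 1 = 1 := by
  rw [coeff_youngSymmetrizer, Finset.sum_eq_single 1]
  · simp
  · intro s hs hne
    refine if_neg fun hcol => hne (Equiv.ext fun i => injective_rowOf_colOf T (Prod.ext ?_ ?_))
    · exact (Finset.mem_filter.1 hs).2 i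
    · simpa using (hcol (s i)).symm
  · intro h
    simp at h

theorem stabSum_mul_mul_stabAlt_mem_span [CommRing k] [IsAddTorsionFree k]
    (T : α ≃ μ.cells) (x : MonoidAlgebra k (Perm α)) :
    stabSum k (rowOf T) * x * stabAlt k (colOf T) ∈ Submodule.span k {youngSymmetrizer k T} := by
  refine mul_mul_mem_of_single (fun g => ?_) x
  by_cases h : Function.Injective fun i => (rowOf T i, colOf T (g⁻¹ i))
  · obtain ⟨s, hrow, hcol⟩ := exists_row_perm T g⁻¹ h
    have hsg (i : α) : colOf T ((s * g) i) = colOf T i := by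
      rw [Perm.mul_apply, hcol, ← Perm.mul_apply, inv_mul_cancel, Perm.one_apply]
    rw [← stabSum_mul_single hrow, mul_assoc (stabSum k _), single_mul_single, mul_one, mul_assoc,
      single_mul_stabAlt hsg, mul_smul_comm]
    exact Submodule.smul_mem _ _ (Submodule.mem_span_singleton_self _)
  · rw [stabSum_mul_single_mul_stabAlt_eq_zero g h]
    exact Submodule.zero_mem _

theorem exists_youngSymmetrizer_sandwich [CommRing k] [IsAddTorsionFree k]
    (T : α ≃ μ.cells) (x : MonoidAlgebra k (Perm α)) :
    ∃ r : k, youngSymmetrizer k T * x * youngSymmetrizer k T = r • youngSymmetrizer k T := by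
  obtain ⟨r, hr⟩ := Submodule.mem_span_singleton.1
    (stabSum_mul_mul_stabAlt_mem_span T (stabAlt k (colOf T) * x * stabSum k (rowOf T)))
  refine ⟨r, ?_⟩
  rw [hr]
  simp only [youngSymmetrizer, mul_assoc]

theorem youngSymmetrizer_mul_mul_eq_zero [CommRing k] [IsAddTorsionFree k]
    {T : α ≃ μ.cells} {T' : α ≃ ν.cells}
    (h : ∀ g : Perm α, ¬ Function.Injective fun i => (rowOf T i, colOf T' (g i)))
    (x : MonoidAlgebra k (Perm α)) :
    youngSymmetrizer k T * x * youngSymmetrizer k T' = 0 := by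
  have hzero (y : MonoidAlgebra k (Perm α)) :
      stabSum k (rowOf T) * y * stabAlt k (colOf T') = 0 :=
    (Submodule.mem_bot k).1 (mul_mul_mem_of_single (fun g => (Submodule.mem_bot k).2
      (stabSum_mul_single_mul_stabAlt_eq_zero g (h g⁻¹))) y)
  rw [← hzero (stabAlt k (colOf T) * x * stabSum k (rowOf T'))]
  simp only [youngSymmetrizer, mul_assoc]

variable [Field k] [CharZero k]

variable (k) in
/-- The idempotent multiple of a Young symmetrizer. -/
def youngIdempotent (T : α ≃ μ.cells) : MonoidAlgebra k (Perm α) :=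
  normalizedIdempotent (youngSymmetrizer k T)

theorem isMinimalIdempotent_youngIdempotent (T : α ≃ μ.cells) :
    IsMinimalIdempotent k (youngIdempotent k T) :=
  isMinimalIdempotent_normalizedIdempotent (coeff_one_youngSymmetrizer T)
    (exists_youngSymmetrizer_sandwich T)

theorem centralIdempotent_mul_centralIdempotent_of_ne (T : α ≃ μ.cells) (T' : α ≃ ν.cells)
    (hne : μ ≠ ν) :
    centralIdempotent (youngIdempotent k T) * centralIdempotent (youngIdempotent k T') = 0 := by
  rcases not_injective_rowOf_colOf_of_ne T T' hne with h | h
  · exact centralIdempotent_mul_centralIdempotent_eq_zero fun x => by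
      simp [youngIdempotent, normalizedIdempotent, youngSymmetrizer_mul_mul_eq_zero h]
  · rw [(commute_centralIdempotent _ _).eq]
    exact centralIdempotent_mul_centralIdempotent_eq_zero fun x => by
      simp [youngIdempotent, normalizedIdempotent, youngSymmetrizer_mul_mul_eq_zero h]

end YoungSymmetrizer

/-! ### Averaging over a subgroup -/

section SubgroupAverage

variable (k : Type*) {G : Type*} [Field k] [Group G] (H : Subgroup G) [Fintype H]

/-- The average of the elements of a finite subgroup; for `k` of characteristic zero it is the
idempotent projecting onto the vectors fixed by the subgroup. -/
def subgroupAvg : MonoidAlgebra k G := (Nat.card H : k)⁻¹ • ∑ h : H, single (h : G) 1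

variable {k H}

theorem coeff_subgroupAvg_mul (x : MonoidAlgebra k G) (g : G) :
    (subgroupAvg k H * x).coeff g = (Nat.card H : k)⁻¹ * ∑ h : H, x.coeff ((h : G)⁻¹ * g) := by
  simp [subgroupAvg, Finset.sum_mul, coeff_sum, coeff_single_mul_apply]

theorem coeff_mul_subgroupAvg (x : MonoidAlgebra k G) (g : G) :
    (x * subgroupAvg k H).coeff g = (Nat.card H : k)⁻¹ * ∑ h : H, x.coeff (g * (h : G)⁻¹) := by
  simp [subgroupAvg, Finset.mul_sum, coeff_sum, coeff_mul_single_apply]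

theorem coeff_subgroupAvg_mul_left (x : MonoidAlgebra k G) {h : G} (hh : h ∈ H) (g : G) :
    (subgroupAvg k H * x).coeff (h * g) = (subgroupAvg k H * x).coeff g := by
  rw [coeff_subgroupAvg_mul, coeff_subgroupAvg_mul]
  congr 1
  exact Fintype.sum_equiv (Equiv.mulLeft (⟨h, hh⟩⁻¹ : H)) _ _ fun u => by simp [mul_assoc]

theorem coeff_mul_subgroupAvg_right (x : MonoidAlgebra k G) {h : G} (hh : h ∈ H) (g : G) :
    (x * subgroupAvg k H).coeff (g * h) = (x * subgroupAvg k H).coeff g := by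
  rw [coeff_mul_subgroupAvg, coeff_mul_subgroupAvg]
  congr 1
  exact Fintype.sum_equiv (Equiv.mulRight (⟨h, hh⟩⁻¹ : H)) _ _ fun u => by simp [mul_assoc]

variable [CharZero k]

theorem subgroupAvg_mul_eq_self {x : MonoidAlgebra k G}
    (hx : ∀ h ∈ H, ∀ g, x.coeff (h * g) = x.coeff g) : subgroupAvg k H * x = x := by
  refine MonoidAlgebra.ext (Finsupp.ext fun g => ?_)
  rw [coeff_subgroupAvg_mul, Finset.sum_congr rfl fun h _ => hx _ (H.inv_mem h.2) g]
  simp [Nat.card_eq_fintype_card]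

theorem mul_subgroupAvg_eq_self {x : MonoidAlgebra k G}
    (hx : ∀ h ∈ H, ∀ g, x.coeff (g * h) = x.coeff g) : x * subgroupAvg k H = x := by
  refine MonoidAlgebra.ext (Finsupp.ext fun g => ?_)
  rw [coeff_mul_subgroupAvg, Finset.sum_congr rfl fun h _ => hx _ (H.inv_mem h.2) g]
  simp [Nat.card_eq_fintype_card]

theorem isIdempotentElem_subgroupAvg : IsIdempotentElem (subgroupAvg k H) :=
  subgroupAvg_mul_eq_self fun h hh g => by
    simpa using coeff_subgroupAvg_mul_left (1 : MonoidAlgebra k G) hh g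

theorem subgroupAvg_mul_ne_zero_of_coeff_eq_natCast {x : MonoidAlgebra k G} {u : G}
    (hx : ∀ h ∈ H, ∃ m : ℕ, x.coeff (h * u) = m) (hu : x.coeff u ≠ 0) :
    subgroupAvg k H * x ≠ 0 := by
  intro h0
  choose m hm using fun h : H => hx (h : G)⁻¹ (H.inv_mem h.2)
  have hsum : ∑ h, m h = 0 := by
    have h := coeff_subgroupAvg_mul (H := H) x u
    simp only [h0, hm, ← Nat.cast_sum, MonoidAlgebra.coeff_zero, Finsupp.zero_apply] at h
    exact Nat.cast_eq_zero.1 ((mul_eq_zero.1 h.symm).resolve_left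
      (inv_ne_zero (Nat.cast_ne_zero.2 Nat.card_pos.ne')))
  have hm1 : m 1 = 0 := Finset.sum_eq_zero_iff.1 hsum 1 (Finset.mem_univ 1)
  exact hu (by simpa [hm1] using hm 1)

end SubgroupAverage

/-! ### The block of a doubled diagram has a vector fixed by the hyperoctahedral group -/

section DoubledTableau

theorem sign_eq_one_of_commute {α : Type*} [Fintype α] [DecidableEq α] {σ τ : Perm α}
    (p : α → Prop) (hτ : ∀ i, p (τ i) ↔ ¬ p i) (hσ : ∀ i, p (σ i) ↔ p i)
    (h : Commute σ τ) : Perm.sign σ = 1 := by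
  classical
  have hσ' (i : α) : ¬ p (σ i) ↔ ¬ p i := not_congr (hσ i)
  have hsplit : σ =
      (σ.subtypePerm hσ).subtypeCongr (σ.subtypePerm (p := fun i => ¬ p i) hσ') := by
    ext i
    by_cases hi : p i
    · rw [Perm.subtypeCongr.left_apply _ _ hi]; rfl
    · rw [Perm.subtypeCongr.right_apply _ _ hi]; rfl
  have hsign : Perm.sign (σ.subtypePerm hσ) =
      Perm.sign (σ.subtypePerm (p := fun i => ¬ p i) hσ') := by
    refine Perm.sign_eq_sign_of_equiv _ _ (τ.subtypeEquiv fun i => by rw [hτ, not_not]) fun i => ?_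
    exact Subtype.ext (Perm.ext_iff.1 h.eq i.1).symm
  rw [hsplit, Perm.sign_subtypeCongr, hsign, Int.units_mul_self]

theorem mem_double {μ : YoungDiagram} {a b : ℕ} : (a, b) ∈ double μ ↔ (a, b / 2) ∈ μ := by
  rw [← YoungDiagram.mem_cells, double]
  simp only [Finset.mem_image, Finset.mem_product, Finset.mem_range, Prod.exists, Prod.mk.injEq,
    YoungDiagram.mem_cells]
  constructor
  · rintro ⟨i, j, e, ⟨h, he⟩, rfl, rfl⟩
    rwa [show (2 * j + e) / 2 = j by omega]
  · intro h
    exact ⟨a, b / 2, b % 2, ⟨h, by omega⟩, rfl, by omega⟩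

theorem double_injective : Function.Injective double := by
  intro μ ν h
  refine YoungDiagram.ext (Finset.ext fun ⟨a, b⟩ => ?_)
  have hab : (a, 2 * b) ∈ double μ ↔ (a, 2 * b) ∈ double ν := by rw [h]
  rwa [mem_double, mem_double, show 2 * b / 2 = b by omega] at hab

/-- The other column of the pair `{2j, 2j + 1}` containing `b`. -/
def pairedCol (b : ℕ) : ℕ := 2 * (b / 2) + (1 - b % 2)

theorem pairedCol_pairedCol (b : ℕ) : pairedCol (pairedCol b) = b := by
  unfold pairedCol; omega

theorem pairedCol_ne (b : ℕ) : pairedCol b ≠ b := by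
  unfold pairedCol; omega

theorem pairedCol_mod_two_eq_zero_iff (b : ℕ) : pairedCol b % 2 = 0 ↔ ¬ b % 2 = 0 := by
  unfold pairedCol; omega

variable {α : Type*} {μ : YoungDiagram}

theorem exists_row_pairing (T : α ≃ (double μ).cells) :
    ∃ τ : α → α, Function.Involutive τ ∧ (∀ i, rowOf T (τ i) = rowOf T i) ∧
      ∀ i, colOf T (τ i) = pairedCol (colOf T i) := by
  have h (i : α) : ∃ j, rowOf T j = rowOf T i ∧ colOf T j = pairedCol (colOf T i) := by
    refine exists_rowOf_colOf T (mem_double.2 ?_)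
    rw [show pairedCol (colOf T i) / 2 = colOf T i / 2 by unfold pairedCol; omega]
    exact mem_double.1 (rowOf_colOf_mem T i)
  choose τ hrow hcol using h
  refine ⟨τ, fun i => injective_rowOf_colOf T (Prod.ext ?_ ?_), hrow, hcol⟩
  · exact (hrow _).trans (hrow i)
  · exact (hcol _).trans ((congrArg pairedCol (hcol i)).trans (pairedCol_pairedCol _))

variable [Fintype α] [DecidableEq α]

/- A permutation commuting with the pairing of the columns is even as soon as it preserves the
columns, so only positive terms survive in the Young symmetrizer. -/
theorem coeff_youngSymmetrizer_eq_natCast {k : Type*} [CommRing k] (T : α ≃ (double μ).cells)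
    {τ g : Perm α} (hrow : ∀ i, rowOf T (τ i) = rowOf T i)
    (hcol : ∀ i, colOf T (τ i) = pairedCol (colOf T i)) (hg : Commute g τ) :
    ∃ m : ℕ, (youngSymmetrizer k T).coeff g = m := by
  have hterm : ∀ s ∈ ({s | ∀ i, rowOf T (s i) = rowOf T i} : Finset (Perm α)),
      (if ∀ i, colOf T ((s⁻¹ * g) i) = colOf T i then ((Perm.sign (s⁻¹ * g) : ℤ) : k) else 0) =
        ((if ∀ i, colOf T ((s⁻¹ * g) i) = colOf T i then 1 else 0 : ℕ) : k) := by
    intro s hs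
    split_ifs with h
    · have hs' (i : α) : rowOf T (s.symm i) = rowOf T i := by
        simpa using ((Finset.mem_filter.1 hs).2 (s.symm i)).symm
      have hcomm : Commute (s⁻¹ * g) τ := Perm.ext fun i =>
        injective_rowOf_colOf T (Prod.ext
          (by simpa [hs', hrow] using congrArg (rowOf T) (Perm.ext_iff.1 hg.eq i))
          (by simpa only [Perm.mul_apply, h, hcol] using
            (h (τ i)).trans ((hcol i).trans (congrArg pairedCol (h i).symm))))
      rw [sign_eq_one_of_commute (fun i => colOf T i % 2 = 0) (fun i => ?_) (fun i => ?_) hcomm]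
      · simp
      · rw [hcol, pairedCol_mod_two_eq_zero_iff]
      · rw [h]
    · simp
  exact ⟨_, by rw [coeff_youngSymmetrizer, Finset.sum_congr rfl hterm, ← Nat.cast_sum]⟩

end DoubledTableau

section Hyperoctahedral

variable {n : ℕ}

instance : Fintype (hyperoctahedral n) := Fintype.ofFinite _

theorem mem_hyperoctahedral_iff {h : Perm (Letters n)} :
    h ∈ hyperoctahedral n ↔ Commute h (flip n) := by
  rw [hyperoctahedral, Subgroup.mem_centralizer_singleton_iff]
  exact ⟨fun h => h, fun h => h⟩

theorem exists_conj_flip {τ : Letters n → Letters n} (hτ : Function.Involutive τ)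
    (hne : ∀ i, τ i ≠ i) : ∃ g : Perm (Letters n), hτ.toPerm τ = g * flip n * g⁻¹ := by
  obtain ⟨g, hg⟩ := exists_smul_basePairing ⟨τ, hτ, hne⟩
  exact ⟨g, Perm.ext fun i => (congrFun (congrArg Pairing.partner hg) i).symm⟩

variable {k : Type*} [Field k] [CharZero k] {μ : YoungDiagram}

theorem exists_subgroupAvg_mul_single_mul_youngSymmetrizer_ne_zero
    (T : Letters n ≃ (double μ).cells) : ∃ g : Perm (Letters n),
      subgroupAvg k (hyperoctahedral n) * (single g 1 * youngSymmetrizer k T) ≠ 0 := by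
  obtain ⟨τ, hτ, hrow, hcol⟩ := exists_row_pairing T
  obtain ⟨g, hg⟩ := exists_conj_flip hτ fun i hi => pairedCol_ne (colOf T i) (by rw [← hcol, hi])
  refine ⟨g⁻¹, subgroupAvg_mul_ne_zero_of_coeff_eq_natCast (u := g⁻¹) (fun h hh => ?_) ?_⟩
  · have hcomm : Commute (g * h * g⁻¹) (hτ.toPerm τ) := by
      rw [hg, ← MulAut.conj_apply, ← MulAut.conj_apply]
      exact (mem_hyperoctahedral_iff.1 hh).map _
    obtain ⟨m, hm⟩ :=
      coeff_youngSymmetrizer_eq_natCast (k := k) T (τ := hτ.toPerm τ) hrow hcol hcomm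
    exact ⟨m, by rw [coeff_single_mul_apply, one_mul, inv_inv, ← mul_assoc, hm]⟩
  · rw [coeff_single_mul_apply, one_mul, inv_inv, mul_inv_cancel, coeff_one_youngSymmetrizer]
    exact one_ne_zero

theorem subgroupAvg_mul_centralIdempotent_ne_zero (T : Letters n ≃ (double μ).cells) :
    subgroupAvg k (hyperoctahedral n) * centralIdempotent (youngIdempotent k T) ≠ 0 := by
  intro h0
  obtain ⟨g, hg⟩ := exists_subgroupAvg_mul_single_mul_youngSymmetrizer_ne_zero (k := k) T
  have he := isMinimalIdempotent_youngIdempotent (k := k) T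
  have hge : subgroupAvg k (hyperoctahedral n) * (single g 1 * youngIdempotent k T) = 0 := by
    nth_rw 1 [← he.centralIdempotent_mul]
    rw [← mul_assoc (single g 1), ← (commute_centralIdempotent _ _).eq, mul_assoc, ← mul_assoc, h0,
      zero_mul]
  have hscalar := left_ne_zero_of_smul he.ne_zero
  rw [youngIdempotent, normalizedIdempotent, mul_smul_comm, mul_smul_comm] at hge
  exact hg ((smul_eq_zero.1 hge).resolve_left hscalar)

end Hyperoctahedral

/-! ### The characters in terms of idempotents -/

section Transport

section GroupEquiv

variable {k l G G' : Type*} [CommSemiring k] [CommSemiring l] [Group G] [Group G']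
  {x : MonoidAlgebra k G} {y : MonoidAlgebra l G'} {σ : k →+* l} {φ : G ≃* G'}

theorem coeff_conjSum_map [Fintype G] [Fintype G'] (h : ∀ g, y.coeff (φ g) = σ (x.coeff g))
    (g : G) : (conjSum y).coeff (φ g) = σ ((conjSum x).coeff g) := by
  rw [coeff_conjSum, coeff_conjSum, map_sum]
  exact (Fintype.sum_equiv φ.toEquiv _ _ fun u => by simp [← h]).symm

theorem coeff_mul_self_map [Finite G] (h : ∀ g, y.coeff (φ g) = σ (x.coeff g)) :
    (y * y).coeff 1 = σ ((x * x).coeff 1) := by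
  have := Fintype.ofFinite G
  have := Fintype.ofEquiv G φ.toEquiv
  rw [coeff_mul_eq_sum, coeff_mul_eq_sum, map_sum]
  exact (Fintype.sum_equiv φ.toEquiv _ _ fun u => by simp [← h]).symm

end GroupEquiv

variable {α β : Type*} [Fintype α] [DecidableEq α] [Fintype β] [DecidableEq β] {μ : YoungDiagram}

theorem coeff_youngSymmetrizer_map {k l : Type*} [CommRing k] [CommRing l]
    (σ : k →+* l) (T : α ≃ μ.cells) (e : α ≃ β) (g : Perm α) :
    (youngSymmetrizer l (e.symm.trans T)).coeff (e.permCongrHom g) =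
      σ ((youngSymmetrizer k T).coeff g) := by
  have hrow (s : Perm α) : (∀ i, rowOf (e.symm.trans T) (e.permCongrHom s i) =
      rowOf (e.symm.trans T) i) ↔ ∀ i, rowOf T (s i) = rowOf T i :=
    e.symm.forall_congr fun i => by simp [rowOf]
  have hcol (s : Perm α) : (∀ i, colOf (e.symm.trans T) (e.permCongrHom s i) =
      colOf (e.symm.trans T) i) ↔ ∀ i, colOf T (s i) = colOf T i :=
    e.symm.forall_congr fun i => by simp [colOf]
  rw [coeff_youngSymmetrizer, coeff_youngSymmetrizer, map_sum]
  refine (Finset.sum_equiv e.permCongrHom.toEquiv (fun s => ?_) fun s _ => ?_).symm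
  · simpa using (hrow s).symm
  · rw [MulEquiv.toEquiv_eq_coe, MulEquiv.coe_toEquiv, ← map_inv, ← map_mul, apply_ite σ]
    simp only [hcol, map_zero, map_intCast]
    rw [Equiv.permCongrHom_coe, Perm.sign_permCongr]

variable {k l : Type*} [Field k] [Field l]

theorem coeff_normalizedIdempotent_map {G G' : Type*} [Group G] [Group G'] [Finite G]
    {x : MonoidAlgebra k G} {y : MonoidAlgebra l G'} {σ : k →+* l} {φ : G ≃* G'}
    (h : ∀ g, y.coeff (φ g) = σ (x.coeff g)) (g : G) :
    (normalizedIdempotent y).coeff (φ g) = σ ((normalizedIdempotent x).coeff g) := by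
  simp [normalizedIdempotent, coeff_mul_self_map h, h]

theorem coeff_youngIdempotent_map (σ : k →+* l) (T : α ≃ μ.cells) (e : α ≃ β) (g : Perm α) :
    (youngIdempotent l (e.symm.trans T)).coeff (e.permCongrHom g) =
      σ ((youngIdempotent k T).coeff g) :=
  coeff_normalizedIdempotent_map (coeff_youngSymmetrizer_map σ T e) g

theorem coeff_youngIdempotent_refl (T : α ≃ μ.cells) (g : Perm α) :
    (youngIdempotent k (Equiv.refl μ.cells)).coeff (T.permCongrHom g) =
      (youngIdempotent k T).coeff g := by
  simpa using coeff_youngIdempotent_map (RingHom.id k) T T g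

theorem map_coeff_youngIdempotent (σ : k →+* l) (T : α ≃ μ.cells) (g : Perm α) :
    σ ((youngIdempotent k T).coeff g) = (youngIdempotent l T).coeff g :=
  (coeff_youngIdempotent_map σ T (Equiv.refl α) g).symm

end Transport

theorem coeff_conjSum_inv {k α : Type*} [CommSemiring k] [Fintype α] [DecidableEq α]
    (c : MonoidAlgebra k (Perm α)) (g : Perm α) :
    (conjSum c).coeff g⁻¹ = (conjSum c).coeff g := by
  obtain ⟨u, hu⟩ := isConj_iff.1 (Perm.isConj_iff_cycleType_eq.2 (Perm.cycleType_inv g).symm)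
  rw [← hu, coeff_conjSum_conj]

section SpechtModule

theorem mem_range_mulRight_iff {k G : Type*} [Field k] [CharZero k] [Group G] [Finite G]
    {c : MonoidAlgebra k G} (h1 : c.coeff 1 = 1) (hc : ∀ x, ∃ r : k, c * x * c = r • c)
    (x : MonoidAlgebra k G) :
    x ∈ LinearMap.range (LinearMap.mulRight k c) ↔ x * normalizedIdempotent c = x := by
  rw [LinearMap.mem_range]
  refine ⟨?_, fun h => ⟨((c * c).coeff 1)⁻¹ • x, ?_⟩⟩
  · rintro ⟨y, rfl⟩
    rw [LinearMap.mulRight_apply, normalizedIdempotent, mul_smul_comm, mul_assoc]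
    nth_rw 2 [mul_self_eq_smul h1 hc]
    rw [mul_smul_comm, inv_smul_smul₀ (coeff_mul_self_one_ne_zero h1 hc)]
  · rw [LinearMap.mulRight_apply, smul_mul_assoc, ← mul_smul_comm]
    exact h

theorem rowSymmetrizer_mul_colAntisymmetrizer (μ : YoungDiagram) :
    rowSymmetrizer μ * colAntisymmetrizer μ = youngSymmetrizer ℂ (Equiv.refl μ.cells) := by
  simp only [rowSymmetrizer, colAntisymmetrizer, youngSymmetrizer, stabSum, stabAlt,
    MonoidAlgebra.of_apply, smul_single', mul_one]
  congr!

theorem mem_spechtModule_iff {μ : YoungDiagram} (x : MonoidAlgebra ℂ (Perm μ.cells)) :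
    x ∈ spechtModule μ ↔ x * youngIdempotent ℂ (Equiv.refl μ.cells) = x := by
  rw [spechtModule, rowSymmetrizer_mul_colAntisymmetrizer]
  exact mem_range_mulRight_iff (coeff_one_youngSymmetrizer _) (exists_youngSymmetrizer_sandwich _) x

theorem character_spechtRep (μ : YoungDiagram) (g : Perm μ.cells) :
    (spechtRep μ).character g =
      (conjSum (youngIdempotent ℂ (Equiv.refl μ.cells))).coeff g := by
  rw [← coeff_conjSum_inv]
  exact trace_mulLeft_restrict_leftIdeal (isMinimalIdempotent_youngIdempotent _).idem
    mem_spechtModule_iff g fun x hx => mul_mem_spechtModule _ hx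

theorem finrank_spechtModule (μ : YoungDiagram) :
    (Module.finrank ℂ (spechtModule μ) : ℂ) =
      Fintype.card (Perm μ.cells) * (youngIdempotent ℂ (Equiv.refl μ.cells)).coeff 1 :=
  finrank_leftIdeal (isMinimalIdempotent_youngIdempotent _).idem mem_spechtModule_iff

variable {n : ℕ} (lam : Young n)

theorem charDouble_eq_coeff (g : Perm (Letters n)) :
    charDouble lam g = (conjSum (youngIdempotent ℂ (numbering lam))).coeff g := by
  rw [charDouble, character_spechtRep]
  exact coeff_conjSum_map (σ := RingHom.id ℂ) (φ := (numbering lam).permCongrHom)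
    (coeff_youngIdempotent_refl _) g

theorem dimDouble_eq : (dimDouble lam : ℂ) =
    Fintype.card (Perm (Letters n)) * (youngIdempotent ℂ (numbering lam)).coeff 1 := by
  rw [dimDouble, finrank_spechtModule, ← coeff_youngIdempotent_refl (numbering lam) 1,
    map_one (numbering lam).permCongrHom, Fintype.card_congr (numbering lam).permCongr]

end SpechtModule

/-! ### Pairs of fixed-point-free involutions -/

section Involutions

variable {α : Type*}

theorem exists_alternating_of_involutive {s : α → α} (hs : Function.Involutive s)
    (hne : ∀ i, s i ≠ i) : ∃ p : α → Prop, ∀ i, p (s i) ↔ ¬ p i := by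
  obtain ⟨_, -⟩ := exists_wellFoundedLT α
  refine ⟨fun i => i < s i, fun i => ?_⟩
  beta_reduce
  rw [hs i, not_lt]
  exact ⟨le_of_lt, fun h => h.lt_of_ne (hne i)⟩

variable {σ τ : Perm α}

theorem zpow_neg_mul_apply_of_involutive (hσ : Function.Involutive σ)
    (hτ : Function.Involutive τ) (m : ℤ) (i : α) :
    ((τ * σ) ^ (-m)) (τ i) = τ (((τ * σ) ^ m) i) := by
  have hττ : τ * τ = 1 := Perm.ext hτ
  have hinv : τ * (τ * σ) * τ⁻¹ = (τ * σ)⁻¹ := by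
    rw [mul_inv_rev, inv_eq_of_mul_eq_one_left hττ, inv_eq_of_mul_eq_one_left (Perm.ext hσ),
      ← mul_assoc τ, hττ, one_mul]
  rw [zpow_neg, ← inv_zpow, ← hinv, conj_zpow, ← Perm.mul_apply, inv_mul_cancel_right,
    Perm.mul_apply]

/- If `(τ σ) ^ k` carried `i` to `τ i`, then `τ` or `σ`, according to the parity of `k`, would fix
the point half way. -/
theorem not_sameCycle_mul_of_involutive (hσ : Function.Involutive σ) (hτ : Function.Involutive τ)
    (hσ' : ∀ i, σ i ≠ i) (hτ' : ∀ i, τ i ≠ i) (i : α) : ¬ (τ * σ).SameCycle i (τ i) := by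
  rintro ⟨k, hk⟩
  obtain ⟨m, rfl | rfl⟩ := k.even_or_odd'
  · refine hτ' (((τ * σ) ^ m) i) ?_
    rw [← zpow_neg_mul_apply_of_involutive hσ hτ, ← hk, ← Perm.mul_apply, ← zpow_add]
    ring_nf
  · refine hσ' (((τ * σ) ^ m) i) (τ.injective ?_)
    rw [← zpow_neg_mul_apply_of_involutive hσ hτ, ← hk, ← Perm.mul_apply, ← Perm.mul_apply,
      ← Perm.mul_apply, ← zpow_add, ← zpow_one_add]
    ring_nf

theorem exists_alternating_of_involutive_pair (hσ : Function.Involutive σ)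
    (hτ : Function.Involutive τ) (hσ' : ∀ i, σ i ≠ i) (hτ' : ∀ i, τ i ≠ i) :
    ∃ p : α → Prop, (∀ i, p (σ i) ↔ ¬ p i) ∧ ∀ i, p (τ i) ↔ ¬ p i := by
  let π := τ * σ
  have hσπ (i : α) : π.SameCycle (σ i) (τ i) := ⟨1, by simp [π, hσ i]⟩
  have hmap (i j : α) : π.SameCycle i j → π.SameCycle (τ i) (τ j) := by
    rintro ⟨m, rfl⟩
    exact ⟨-m, zpow_neg_mul_apply_of_involutive hσ hτ m i⟩
  let s : Quotient (Perm.SameCycle.setoid π) → Quotient (Perm.SameCycle.setoid π) :=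
    Quotient.map τ hmap
  obtain ⟨p, hp⟩ := exists_alternating_of_involutive (s := s)
    (fun c => Quotient.inductionOn c fun i => congrArg _ (hτ i))
    (fun c => Quotient.inductionOn c fun i h =>
      not_sameCycle_mul_of_involutive hσ hτ hσ' hτ' i (Quotient.exact h).symm)
  refine ⟨fun i => p ⟦i⟧, fun i => ?_, fun i => hp ⟦i⟧⟩
  beta_reduce
  rw [show (⟦σ i⟧ : Quotient (Perm.SameCycle.setoid π)) = ⟦τ i⟧ from Quotient.sound (hσπ i)]
  exact hp ⟦i⟧

variable {p q : α → Prop}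

theorem two_mul_card_of_alternating [Finite α] (hp : ∀ i, p (τ i) ↔ ¬ p i) :
    2 * Nat.card {i // p i} = Nat.card α := by
  classical
  have hcard : Nat.card {i // p i} = Nat.card {i // ¬ p i} :=
    Nat.card_congr (τ.subtypeEquiv fun i => by rw [hp, not_not])
  rw [← Nat.card_congr (Equiv.sumCompl p), Nat.card_sum, ← hcard, two_mul]

theorem exists_commute_extending (hτ : Function.Involutive τ) (hp : ∀ i, p (τ i) ↔ ¬ p i)
    (hq : ∀ i, q (τ i) ↔ ¬ q i) (φ : {i // p i} ≃ {i // q i}) :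
    ∃ h : Perm α, Commute h τ ∧ ∀ i : {i // p i}, h i = φ i := by
  classical
  let ψ : {i // ¬ p i} ≃ {i // ¬ q i} :=
    ((τ.subtypeEquiv fun i => (hp i).symm).trans φ).trans
      (τ.subtypeEquiv fun i => by rw [hq, not_not])
  have hφ (i : α) (hi : p i) : φ.subtypeCongr ψ i = φ ⟨i, hi⟩ := by
    simp [Equiv.subtypeCongr, hi]
  have hψ (i : α) (hi : ¬ p i) : φ.subtypeCongr ψ i = τ (φ ⟨τ i, (hp i).2 hi⟩) := by
    simp [Equiv.subtypeCongr, hi, ψ]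
  refine ⟨φ.subtypeCongr ψ, Perm.ext fun i => ?_, fun i => hφ i i.2⟩
  rw [Perm.mul_apply, Perm.mul_apply]
  by_cases hi : p i
  · rw [hφ i hi, hψ (τ i) fun h => (hp i).1 h hi]
    simp only [hτ i]
  · rw [hψ i hi, hφ (τ i) ((hp i).2 hi), hτ]

/- On the points of one colour the pair `(σ, τ)` is remembered by the permutation `τ σ` alone. -/
theorem exists_commute_conj_of_conj {σ' : Perm α} (hσ : Function.Involutive σ)
    (hσ' : Function.Involutive σ') (hτ : Function.Involutive τ) (hpσ : ∀ i, p (σ i) ↔ ¬ p i)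
    (hp : ∀ i, p (τ i) ↔ ¬ p i) (hq : ∀ i, q (τ i) ↔ ¬ q i) (φ : {i // p i} ≃ {i // q i})
    (hφ : ∀ i j : {i // p i}, (j : α) = τ (σ i) → (φ j : α) = τ (σ' (φ i))) :
    ∃ h : Perm α, Commute h τ ∧ h * σ = σ' * h := by
  obtain ⟨h, hcomm, hext⟩ := exists_commute_extending hτ hp hq φ
  have hpos (i : α) (hi : p i) : h (σ i) = σ' (h i) := by
    have hj : p (τ (σ i)) := by rw [hp, hpσ, not_not]; exact hi
    have hτh : h (τ (σ i)) = τ (h (σ i)) := Perm.ext_iff.1 hcomm.eq (σ i)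
    apply τ.injective
    rw [← hτh, hext ⟨_, hj⟩, hext ⟨i, hi⟩, hφ ⟨i, hi⟩ ⟨_, hj⟩ rfl]
  refine ⟨h, hcomm, Perm.ext fun i => ?_⟩
  by_cases hi : p i
  · exact hpos i hi
  · have hi' := hpos (σ i) ((hpσ i).2 hi)
    rw [hσ i] at hi'
    rw [Perm.mul_apply, Perm.mul_apply, hi', hσ']

end Involutions

section OrbitTypes

theorem card_cellsOfRowLens (w : List ℕ) : (YoungDiagram.cellsOfRowLens w).card = w.sum := by
  induction w with
  | nil => simp [YoungDiagram.cellsOfRowLens]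
  | cons a w ih =>
    have hdisj : Disjoint (({0} : Finset ℕ) ×ˢ Finset.range a)
        ((YoungDiagram.cellsOfRowLens w).map
          (Function.Embedding.prodMap ⟨_, Nat.succ_injective⟩ (Function.Embedding.refl ℕ))) := by
      simp [Finset.disjoint_left]
    rw [YoungDiagram.cellsOfRowLens, Finset.card_union_of_disjoint hdisj, Finset.card_map, ih]
    simp

/-- The Young diagram whose rows are the parts of a partition. -/
def youngOfPartition {m : ℕ} (p : m.Partition) : Young m :=
  ⟨YoungDiagram.ofRowLens (p.parts.sort (· ≥ ·)) (p.parts.pairwise_sort _).sortedGE, by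
    refine (card_cellsOfRowLens _).trans ?_
    rw [← Multiset.sum_coe, Multiset.sort_eq, p.parts_sum]⟩

theorem rowLens_youngOfPartition {m : ℕ} (p : m.Partition) :
    (youngOfPartition p).1.rowLens = p.parts.sort (· ≥ ·) :=
  YoungDiagram.rowLens_ofRowLens_eq_self (hw := (p.parts.pairwise_sort _).sortedGE)
    fun _ hx => p.parts_pos ((Multiset.mem_sort _).1 hx)

theorem youngOfPartition_injective {m : ℕ} :
    Function.Injective (youngOfPartition : m.Partition → Young m) := by
  intro p q h
  refine Nat.Partition.ext ?_
  rw [← Multiset.sort_eq p.parts (· ≥ ·), ← Multiset.sort_eq q.parts (· ≥ ·),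
    ← rowLens_youngOfPartition, ← rowLens_youngOfPartition, h]

theorem exists_orbit_type (n : ℕ) : ∃ t : Pairing n → Young n,
    ∀ x y, t x = t y → ∃ h ∈ hyperoctahedral n, h • x = y := by
  classical
  let ρ (x : Pairing n) : Perm (Letters n) := Function.Involutive.toPerm x.partner x.partner_partner
  choose p hρ hflip using fun x : Pairing n => exists_alternating_of_involutive_pair
    (σ := ρ x) x.partner_partner (flip_flip (n := n)) x.partner_ne flip_ne
  have hcard (x : Pairing n) : Fintype.card {i // p x i} = n := by
    have h := two_mul_card_of_alternating (hflip x)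
    rw [Nat.card_eq_fintype_card, Nat.card_eq_fintype_card, card_letters] at h
    omega
  let e (x : Pairing n) : {i // p x i} ≃ Fin n := Fintype.equivFinOfCardEq (hcard x)
  let π (x : Pairing n) : Perm {i // p x i} :=
    (flip n * ρ x).subtypePerm fun i => by rw [Perm.mul_apply, hflip, hρ, not_not]
  let t (x : Pairing n) : Young n := ⟨(youngOfPartition ((e x).permCongr (π x)).partition).1,
    (youngOfPartition ((e x).permCongr (π x)).partition).2.trans (Fintype.card_fin n)⟩
  refine ⟨t, fun x y hxy => ?_⟩
  have htype : ((e x).permCongr (π x)).partition = ((e y).permCongr (π y)).partition :=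
    youngOfPartition_injective (Subtype.ext (Subtype.mk.inj hxy))
  obtain ⟨c, hc⟩ := isConj_iff.1 (Perm.partition_eq_of_isConj.2 htype)
  rw [mul_inv_eq_iff_eq_mul] at hc
  obtain ⟨h, hcomm, hρh⟩ := exists_commute_conj_of_conj (σ := ρ x) (σ' := ρ y) x.partner_partner
    y.partner_partner (flip_flip (n := n)) (hρ x) (hflip x) (hflip y)
    ((e x).trans (c.trans (e y).symm)) fun i j hij => by
      obtain rfl : j = π x i := Subtype.ext hij
      have hcx := congrArg (fun τ : Perm (Fin n) => ((e y).symm (τ (e x i)) : Letters n)) hc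
      simp only [Perm.mul_apply, Equiv.permCongr_apply, Equiv.symm_apply_apply] at hcx
      exact hcx
  refine ⟨h, mem_hyperoctahedral_iff.2 hcomm, Pairing.ext (funext fun k => ?_)⟩
  obtain ⟨i, rfl⟩ := h.surjective k
  rw [smul_partner']
  exact Perm.ext_iff.1 hρh i

end OrbitTypes

theorem smul_basePairing_iff {n : ℕ} {g : Perm (Letters n)} :
    g • basePairing n = basePairing n ↔ g ∈ hyperoctahedral n := by
  rw [mem_hyperoctahedral_iff, commute_iff_eq, Perm.ext_iff]
  constructor
  · intro h i
    have hi := smul_partner' g (basePairing n) i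
    rw [h] at hi
    exact hi.symm
  · intro h
    refine Pairing.ext (funext fun k => ?_)
    obtain ⟨i, rfl⟩ := g.surjective k
    rw [smul_partner']
    exact h i

theorem exists_mul_mul_of_orbit {n : ℕ} {g g' h : Perm (Letters n)}
    (hh : h • g • basePairing n = g' • basePairing n) :
    ∃ k ∈ hyperoctahedral n, g' = h * g * k := by
  refine ⟨(h * g)⁻¹ * g', ?_, by group⟩
  rw [← smul_basePairing_iff, mul_smul, ← hh, ← mul_smul h g, inv_smul_smul]

/-! ### Zonal idempotents -/

section Spanning

variable {k ι : Type*} [Field k]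

theorem mem_span_range_of_factorsThrough [Finite ι] {X : Type*} {t : X → ι} {v : ι → X → k}
    (hv : LinearIndependent k v) (hvt : ∀ i, (v i).FactorsThrough t) {w : X → k}
    (hw : w.FactorsThrough t) : w ∈ Submodule.span k (Set.range v) := by
  have := Fintype.ofFinite ι
  let R := LinearMap.range (LinearMap.funLeft k k t)
  have hR {w : X → k} (hw : w.FactorsThrough t) : w ∈ R :=
    ⟨Function.extend t w 0, funext fun x => hw.extend_apply 0 x⟩
  have hcard : Module.finrank k R ≤ Fintype.card ι :=
    (LinearMap.finrank_range_le _).trans_eq (Module.finrank_fintype_fun_eq_card k)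
  rw [Submodule.eq_of_le_of_finrank_le
    (Submodule.span_le.2 (Set.range_subset_iff.2 fun i => hR (hvt i)))
    (hcard.trans_eq (finrank_span_eq_card hv).symm)]
  exact hR hw

variable {A : Type*} [Ring A] [Algebra k A] {e : ι → A}

theorem sum_smul_mul_of_orthogonalIdempotents (he : OrthogonalIdempotents e) (d : ι → k)
    {s : Finset ι} {i : ι} (hi : i ∈ s) : (∑ j ∈ s, d j • e j) * e i = d i • e i := by
  classical
  simp [Finset.sum_mul, he.mul_eq, hi]

theorem linearIndependent_of_orthogonalIdempotents (he : OrthogonalIdempotents e)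
    (hne : ∀ i, e i ≠ 0) : LinearIndependent k e := by
  refine linearIndependent_iff'.2 fun s d hd i hi => ?_
  have h := sum_smul_mul_of_orthogonalIdempotents he d hi
  rw [hd, zero_mul] at h
  exact (smul_eq_zero.1 h.symm).resolve_right (hne i)

end Spanning

/-- The idempotent of the group algebra of `S(2n)` that projects the regular representation to the
vectors of its block `2λ` that are fixed by `H(n)`; its coefficients are those of the zonal
spherical function `w^λ`, up to a scalar. -/
def zonalIdempotent {n : ℕ} (lam : Young n) : MonoidAlgebra ℂ (Perm (Letters n)) :=
  subgroupAvg ℂ (hyperoctahedral n) * centralIdempotent (youngIdempotent ℂ (numbering lam))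

section ZonalIdempotent

variable {n : ℕ} (lam : Young n)

theorem zonalIdempotent_ne_zero : zonalIdempotent lam ≠ 0 :=
  subgroupAvg_mul_centralIdempotent_ne_zero _

theorem zonalIdempotent_mul_zonalIdempotent_of_ne {lam lam' : Young n} (hne : lam ≠ lam') :
    zonalIdempotent lam * zonalIdempotent lam' = 0 := by
  have hne' : double lam.1 ≠ double lam'.1 := fun h => hne (Subtype.ext (double_injective h))
  rw [zonalIdempotent, zonalIdempotent, (commute_centralIdempotent _ _).mul_mul_mul_comm,
    centralIdempotent_mul_centralIdempotent_of_ne _ _ hne', mul_zero]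

theorem orthogonalIdempotents_zonalIdempotent (n : ℕ) :
    OrthogonalIdempotents (zonalIdempotent (n := n)) where
  idem _ := isIdempotentElem_subgroupAvg.mul_of_commute (commute_centralIdempotent _ _).symm
    (isMinimalIdempotent_youngIdempotent _).isIdempotentElem_centralIdempotent
  ortho _ _ := zonalIdempotent_mul_zonalIdempotent_of_ne

theorem subgroupAvg_mul_zonalIdempotent :
    subgroupAvg ℂ (hyperoctahedral n) * zonalIdempotent lam = zonalIdempotent lam := by
  rw [zonalIdempotent, ← mul_assoc, isIdempotentElem_subgroupAvg.eq]

theorem zonalIdempotent_mul_subgroupAvg :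
    zonalIdempotent lam * subgroupAvg ℂ (hyperoctahedral n) = zonalIdempotent lam := by
  rw [zonalIdempotent, mul_assoc, (commute_centralIdempotent _ _).eq, ← mul_assoc,
    isIdempotentElem_subgroupAvg.eq]

theorem centralIdempotent_mul_zonalIdempotent :
    centralIdempotent (youngIdempotent ℂ (numbering lam)) * zonalIdempotent lam =
      zonalIdempotent lam := by
  have hmin := isMinimalIdempotent_youngIdempotent (k := ℂ) (numbering lam)
  rw [zonalIdempotent, (commute_centralIdempotent _ _).left_comm,
    hmin.isIdempotentElem_centralIdempotent.eq]

theorem zonal_eq_sum (g : Perm (Letters n)) :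
    zonal lam g = (Nat.card (hyperoctahedral n) : ℂ)⁻¹ *
      ∑ h : hyperoctahedral n, charDouble lam (g * (h : Perm (Letters n))) := by
  rw [zonal]
  congr!

theorem coeff_zonalIdempotent (g : Perm (Letters n)) :
    (zonalIdempotent lam).coeff g =
      (youngIdempotent ℂ (numbering lam)).coeff 1 * zonal lam g := by
  rw [zonalIdempotent, ← (commute_centralIdempotent _ _).eq, coeff_mul_subgroupAvg, zonal_eq_sum,
    mul_left_comm, ← Equiv.sum_comp (Equiv.inv (hyperoctahedral n)),
    Finset.mul_sum _ _ (MonoidAlgebra.coeff _ 1)]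
  simp [centralIdempotent, charDouble_eq_coeff]

theorem charDouble_inv (g : Perm (Letters n)) : charDouble lam g⁻¹ = charDouble lam g := by
  rw [charDouble_eq_coeff, charDouble_eq_coeff, coeff_conjSum_inv]

theorem charDouble_mul_comm (g g' : Perm (Letters n)) :
    charDouble lam (g * g') = charDouble lam (g' * g) := by
  rw [charDouble_eq_coeff, charDouble_eq_coeff, ← coeff_conjSum_conj _ (g * g') g', ← mul_assoc,
    mul_inv_cancel_right]

theorem conj_coeff_youngIdempotent {α : Type*} [Fintype α] [DecidableEq α] {μ : YoungDiagram}
    (T : α ≃ μ.cells) (g : Perm α) :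
    (starRingEnd ℂ) ((youngIdempotent ℂ T).coeff g) = (youngIdempotent ℂ T).coeff g :=
  map_coeff_youngIdempotent (starRingEnd ℂ) T g

theorem conj_charDouble (g : Perm (Letters n)) :
    (starRingEnd ℂ) (charDouble lam g) = charDouble lam g := by
  rw [charDouble_eq_coeff]
  exact (coeff_conjSum_map (φ := MulEquiv.refl _) (fun u =>
    (conj_coeff_youngIdempotent (numbering lam) u).symm) g).symm

theorem conj_zonal (g : Perm (Letters n)) :
    (starRingEnd ℂ) (zonal lam g) = zonal lam g⁻¹ := by
  simp only [zonal_eq_sum, map_mul, map_sum, map_inv₀, map_natCast, conj_charDouble]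
  refine congrArg _ (Fintype.sum_equiv (Equiv.inv (hyperoctahedral n)) _ _ fun h => ?_)
  rw [← charDouble_inv, mul_inv_rev, charDouble_mul_comm]
  rfl

theorem exists_eq_sum_smul_zonalIdempotent {x : MonoidAlgebra ℂ (Perm (Letters n))}
    (hl : subgroupAvg ℂ (hyperoctahedral n) * x = x)
    (hr : x * subgroupAvg ℂ (hyperoctahedral n) = x) :
    ∃ d : Young n → ℂ, x = ∑ lam, d lam • zonalIdempotent lam := by
  obtain ⟨t, ht⟩ := exists_orbit_type n
  have hfactor {x : MonoidAlgebra ℂ (Perm (Letters n))}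
      (hl : subgroupAvg ℂ (hyperoctahedral n) * x = x)
      (hr : x * subgroupAvg ℂ (hyperoctahedral n) = x) :
      Function.FactorsThrough x.coeff fun g => t (g • basePairing n) := by
    intro g g' hgg'
    obtain ⟨h, hh, hgg'⟩ := ht _ _ hgg'
    obtain ⟨h', hh', rfl⟩ := exists_mul_mul_of_orbit hgg'
    rw [← hr, coeff_mul_subgroupAvg_right _ hh', hr, ← hl, coeff_subgroupAvg_mul_left _ hh]
  let L : MonoidAlgebra ℂ (Perm (Letters n)) →ₗ[ℂ] Perm (Letters n) → ℂ :=
    { toFun x := x.coeff, map_add' _ _ := rfl, map_smul' _ _ := rfl }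
  have hL : Function.Injective L := fun x y h => MonoidAlgebra.ext (DFunLike.coe_injective h)
  have hli := (linearIndependent_of_orthogonalIdempotents (orthogonalIdempotents_zonalIdempotent n)
    zonalIdempotent_ne_zero).map' L (LinearMap.ker_eq_bot.2 hL)
  have hmem : L x ∈ Submodule.span ℂ (Set.range (L ∘ zonalIdempotent (n := n))) :=
    mem_span_range_of_factorsThrough hli (fun lam => hfactor (subgroupAvg_mul_zonalIdempotent lam)
      (zonalIdempotent_mul_subgroupAvg lam)) (hfactor hl hr)
  obtain ⟨d, hd⟩ := (Submodule.mem_span_range_iff_exists_fun ℂ).1 hmem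
  exact ⟨d, hL (by rw [← hd, map_sum]; simp)⟩

/- The Hecke algebra `E ℂ[S(2n)] E` of the averaging idempotent `E` is spanned by the zonal
idempotents, and `f x f = f (E x E) f` for each of them. -/
theorem isMinimalIdempotent_zonalIdempotent : IsMinimalIdempotent ℂ (zonalIdempotent lam) where
  idem := (orthogonalIdempotents_zonalIdempotent n).idem lam
  ne_zero := zonalIdempotent_ne_zero lam
  sandwich x := by
    set E := subgroupAvg ℂ (hyperoctahedral n)
    set f := zonalIdempotent lam
    have hE : E * E = E := isIdempotentElem_subgroupAvg
    obtain ⟨d, hd⟩ := exists_eq_sum_smul_zonalIdempotent (x := E * x * E)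
      (by rw [← mul_assoc, ← mul_assoc, hE]) (by rw [mul_assoc _ E, hE])
    refine ⟨d lam, ?_⟩
    calc f * x * f = f * E * x * (E * f) := by
          rw [zonalIdempotent_mul_subgroupAvg, subgroupAvg_mul_zonalIdempotent]
      _ = f * (E * x * E * f) := by simp only [mul_assoc]
      _ = d lam • f := by
          rw [hd, sum_smul_mul_of_orthogonalIdempotents (orthogonalIdempotents_zonalIdempotent n) d
            (Finset.mem_univ lam), mul_smul_comm,
            (orthogonalIdempotents_zonalIdempotent n).idem lam]

theorem coeff_one_zonalIdempotent :
    (zonalIdempotent lam).coeff 1 = (youngIdempotent ℂ (numbering lam)).coeff 1 :=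
  ((isMinimalIdempotent_youngIdempotent _).coeff_one_eq_of_centralIdempotent_mul
    (isMinimalIdempotent_zonalIdempotent lam) (centralIdempotent_mul_zonalIdempotent lam)).symm

theorem zonal_one : zonal lam 1 = 1 := by
  have hcoeff := (isMinimalIdempotent_youngIdempotent (k := ℂ) (numbering lam)).coeff_one_ne_zero
  have h := coeff_zonalIdempotent lam 1
  rw [coeff_one_zonalIdempotent] at h
  exact (left_eq_mul₀ hcoeff).1 h

theorem sum_coeff_mul_conj_zonal (d : Young n → ℂ) (g : Perm (Letters n)) :
    ∑ u, (∑ mu, d mu • zonalIdempotent mu).coeff (g * u) * (starRingEnd ℂ) (zonal lam u) =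
      d lam * zonal lam g := by
  have hcoeff := (isMinimalIdempotent_youngIdempotent (k := ℂ) (numbering lam)).coeff_one_ne_zero
  refine mul_left_cancel₀ hcoeff ?_
  rw [mul_left_comm, ← coeff_zonalIdempotent, ← smul_eq_mul (d lam), ← Finsupp.smul_apply,
    ← coeff_smul,
    ← sum_smul_mul_of_orthogonalIdempotents (orthogonalIdempotents_zonalIdempotent n) _
      (Finset.mem_univ lam), coeff_mul_eq_sum, Finset.mul_sum]
  exact Finset.sum_congr rfl fun u _ => by
    rw [conj_zonal, coeff_zonalIdempotent lam u⁻¹, mul_left_comm]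

end ZonalIdempotent

/-! ### The spherical function -/

theorem inv_card_mul_sum_eq_inv_card_mul_sum_smul {k G X : Type*} [Field k] [CharZero k] [Group G]
    [Fintype G] [Fintype X] [MulAction G X] {x₀ : X} (hx₀ : ∀ x, ∃ g : G, g • x₀ = x) (F : X → k) :
    (Fintype.card X : k)⁻¹ * ∑ x, F x = (Fintype.card G : k)⁻¹ * ∑ g : G, F (g • x₀) := by
  have hbase (x : X) : ∑ g : G, F (g • x) = ∑ g : G, F (g • x₀) := by
    obtain ⟨u, rfl⟩ := hx₀ x
    exact Fintype.sum_equiv (Equiv.mulRight u) _ _ fun g => by simp [mul_smul]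
  have hcount : (Fintype.card X : k) * ∑ g : G, F (g • x₀) = Fintype.card G * ∑ x, F x := by
    calc (Fintype.card X : k) * ∑ g : G, F (g • x₀) = ∑ x, ∑ g : G, F (g • x) := by
          simp [hbase]
      _ = ∑ g : G, ∑ x, F (g • x) := Finset.sum_comm
      _ = Fintype.card G * ∑ x, F x := by
          simp [fun g : G => show ∑ x, F (g • x) = ∑ x, F x from
            Equiv.sum_comp (MulAction.toPerm g) F]
  have : Nonempty X := ⟨x₀⟩
  have hX : (Fintype.card X : k) ≠ 0 := Nat.cast_ne_zero.2 Fintype.card_ne_zero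
  have hG : (Fintype.card G : k) ≠ 0 := Nat.cast_ne_zero.2 Fintype.card_ne_zero
  rw [inv_mul_eq_iff_eq_mul₀ hX, mul_left_comm, hcount, inv_mul_cancel_left₀ hG]

section ZonalExpansion

variable {n : ℕ} {F : Pairing n → ℂ}

/-- The element of the group algebra of `S(2n)` whose coefficients are the values of the lift of a
function from `X(n)` to `S(2n)`. -/
def liftPairing (F : Pairing n → ℂ) : MonoidAlgebra ℂ (Perm (Letters n)) :=
  ∑ u, single u (F (u • basePairing n))

theorem coeff_liftPairing (F : Pairing n → ℂ) (u : Perm (Letters n)) :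
    (liftPairing F).coeff u = F (u • basePairing n) := by
  classical
  simp [liftPairing, coeff_sum, coeff_single, Finsupp.single_apply]

theorem exists_liftPairing_eq_sum_smul_zonalIdempotent
    (hF : ∀ h ∈ hyperoctahedral n, ∀ x, F (h • x) = F x) :
    ∃ d : Young n → ℂ, liftPairing F = ∑ lam, d lam • zonalIdempotent lam := by
  refine exists_eq_sum_smul_zonalIdempotent
    (subgroupAvg_mul_eq_self fun h hh g => ?_) (mul_subgroupAvg_eq_self fun h hh g => ?_)
  · rw [coeff_liftPairing, coeff_liftPairing, mul_smul, hF h hh]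
  · rw [coeff_liftPairing, coeff_liftPairing, mul_smul, smul_basePairing_iff.2 hh]

variable (lam : Young n)

theorem coeff_zonalIdempotent_eq_dimDouble (u : Perm (Letters n)) :
    (zonalIdempotent lam).coeff u =
      dimDouble lam / Fintype.card (Perm (Letters n)) * zonal lam u := by
  rw [coeff_zonalIdempotent, dimDouble_eq,
    mul_div_cancel_left₀ _ (Nat.cast_ne_zero.2 Fintype.card_ne_zero)]

theorem zonal_mul_right {h : Perm (Letters n)} (hh : h ∈ hyperoctahedral n)
    (u : Perm (Letters n)) : zonal lam (u * h) = zonal lam u := by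
  have hcoeff := (isMinimalIdempotent_youngIdempotent (k := ℂ) (numbering lam)).coeff_one_ne_zero
  refine mul_left_cancel₀ hcoeff ?_
  rw [← coeff_zonalIdempotent, ← coeff_zonalIdempotent, ← zonalIdempotent_mul_subgroupAvg,
    coeff_mul_subgroupAvg_right _ hh]

theorem descend_zonal (u : Perm (Letters n)) :
    descend (zonal lam) (u • basePairing n) = zonal lam u := by
  obtain ⟨h, hh, hu⟩ := exists_mul_mul_of_orbit (h := 1)
    ((one_smul _ _).trans (exists_smul_basePairing (u • basePairing n)).choose_spec.symm)
  rw [descend, hu, one_mul, zonal_mul_right lam hh]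

theorem innerX_eq_sum_perm (F F' : Pairing n → ℂ) :
    innerX F F' = (Fintype.card (Perm (Letters n)) : ℂ)⁻¹ *
      ∑ u : Perm (Letters n), F (u • basePairing n) * (starRingEnd ℂ) (F' (u • basePairing n)) :=
  inv_card_mul_sum_eq_inv_card_mul_sum_smul exists_smul_basePairing _

theorem innerX_smul_zonalNormalized_of_eq_sum {d : Young n → ℂ}
    (hd : liftPairing F = ∑ mu, d mu • zonalIdempotent mu) (g : Perm (Letters n)) :
    innerX (fun x => F (g • x)) (zonalNormalized lam) =
      (√(dimDouble lam : ℝ) : ℝ) / Fintype.card (Perm (Letters n)) * d lam * zonal lam g := by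
  rw [mul_assoc, ← sum_coeff_mul_conj_zonal, ← hd, innerX_eq_sum_perm, div_mul_eq_mul_div,
    div_eq_inv_mul]
  simp only [zonalNormalized, descend_zonal, coeff_liftPairing, map_mul, Complex.conj_ofReal,
    mul_smul, Finset.mul_sum, mul_left_comm]

theorem innerX_smul_zonalNormalized (hF : ∀ h ∈ hyperoctahedral n, ∀ x, F (h • x) = F x)
    (g : Perm (Letters n)) : innerX (fun x => F (g • x)) (zonalNormalized lam) =
      innerX F (zonalNormalized lam) * zonal lam g := by
  obtain ⟨d, hd⟩ := exists_liftPairing_eq_sum_smul_zonalIdempotent hF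
  have hd₁ := innerX_smul_zonalNormalized_of_eq_sum lam hd 1
  simp only [one_smul, zonal_one, mul_one] at hd₁
  rw [innerX_smul_zonalNormalized_of_eq_sum lam hd, hd₁]

theorem eq_sum_innerX_mul_zonalNormalized (hF : ∀ h ∈ hyperoctahedral n, ∀ x, F (h • x) = F x)
    (x : Pairing n) :
    F x = ∑ lam, innerX F (zonalNormalized lam) * zonalNormalized lam x := by
  obtain ⟨d, hd⟩ := exists_liftPairing_eq_sum_smul_zonalIdempotent hF
  obtain ⟨u, rfl⟩ := exists_smul_basePairing x
  rw [← coeff_liftPairing F, hd, coeff_sum, Finsupp.finsetSum_apply]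
  refine Finset.sum_congr rfl fun lam _ => ?_
  have hd₁ := innerX_smul_zonalNormalized_of_eq_sum lam hd 1
  simp only [one_smul, zonal_one, mul_one] at hd₁
  have hsq : ((√(dimDouble lam : ℝ) : ℝ) : ℂ) * (√(dimDouble lam : ℝ) : ℝ) = dimDouble lam := by
    rw [← Complex.ofReal_mul, Real.mul_self_sqrt (Nat.cast_nonneg _), Complex.ofReal_natCast]
  rw [hd₁, zonalNormalized, descend_zonal, coeff_smul, Finsupp.smul_apply, smul_eq_mul,
    coeff_zonalIdempotent_eq_dimDouble, ← hsq]
  ring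

theorem innerX_smul_self_eq_sum_zonal (hF : ∀ h ∈ hyperoctahedral n, ∀ x, F (h • x) = F x)
    (g : Perm (Letters n)) : innerX (fun x => F (g • x)) F =
      ∑ lam, ((‖innerX F (zonalNormalized lam)‖ ^ 2 : ℝ) : ℂ) * zonal lam g := by
  have hexpand (F' : Pairing n → ℂ) : innerX F' F = ∑ lam,
      (starRingEnd ℂ) (innerX F (zonalNormalized lam)) * innerX F' (zonalNormalized lam) := by
    have hconj (x : Pairing n) : (starRingEnd ℂ) (F x) = ∑ lam,
        (starRingEnd ℂ) (innerX F (zonalNormalized lam)) *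
          (starRingEnd ℂ) (zonalNormalized lam x) := by
      conv_lhs => rw [eq_sum_innerX_mul_zonalNormalized hF x]
      simp only [map_sum, map_mul]
    rw [innerX]
    simp only [hconj]
    simp only [innerX, Finset.mul_sum]
    rw [Finset.sum_comm]
    exact Finset.sum_congr rfl fun lam _ => Finset.sum_congr rfl fun x _ => by ring
  rw [hexpand]
  refine Finset.sum_congr rfl fun lam _ => ?_
  rw [innerX_smul_zonalNormalized lam hF, ← mul_assoc, Complex.conj_mul', Complex.ofReal_pow]

end ZonalExpansion

theorem integral_comp_p {t : ℝ} (ht : 0 < t) {n : ℕ} (F : Pairing n → ℂ) :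
    ∫ x, F (x.p n) ∂ewens ht = ∑ y, (weight t y : ℂ) * F y := by
  have hp := (XLim.measurable_p n).aemeasurable (μ := ewens ht)
  have := Measure.isProbabilityMeasure_map hp
  have hweight (y : Pairing n) : 0 ≤ weight t y := by unfold weight; positivity
  rw [← integral_map hp (measurable_of_countable F).aestronglyMeasurable,
    integral_fintype Integrable.of_finite]
  refine Finset.sum_congr rfl fun y _ => ?_
  rw [Measure.real, Measure.map_apply (XLim.measurable_p n) (measurableSet_singleton y),
    ewens_cylinder, ENNReal.toReal_ofReal (hweight y), Complex.real_smul]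

theorem sum_weight {t : ℝ} (ht : 0 < t) (n : ℕ) : ∑ y : Pairing n, weight t y = 1 := by
  have h := integral_comp_p ht (n := n) fun _ => 1
  simp only [integral_const, probReal_univ, one_smul, mul_one] at h
  exact_mod_cast h.symm

theorem card_pairing (n : ℕ) :
    (Fintype.card (Pairing n) : ℝ) = ∏ k ∈ Finset.range n, (2 * (k : ℝ) + 1) := by
  have h := sum_weight one_pos n
  have h0 : ∏ k ∈ Finset.range n, (1 + 2 * (k : ℝ)) ≠ 0 :=
    Finset.prod_ne_zero_iff.2 fun k _ => by positivity
  simp only [weight, one_pow, Finset.sum_const, Finset.card_univ, nsmul_eq_mul, one_div] at h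
  simpa only [add_comm] using (mul_inv_eq_one₀ h0).1 h

section SphericalFunction

variable {z : ℂ} {n : ℕ}

theorem Fz_mul_conj_Fz (hz : z ≠ 0) (x y : Pairing n) : Fz z n x * (starRingEnd ℂ) (Fz z n y) =
    Fintype.card (Pairing n) *
      ((weight (‖z‖ ^ 2) y : ℂ) * z ^ ((x.circles : ℤ) - y.circles)) := by
  have hconj : z ^ y.circles * (starRingEnd ℂ) z ^ y.circles = ((‖z‖ ^ 2) ^ y.circles : ℝ) := by
    rw [← mul_pow, Complex.mul_conj', Complex.ofReal_pow, Complex.ofReal_pow]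
  have hsqrt : ((√(Fintype.card (Pairing n) / ∏ k ∈ Finset.range n, (‖z‖ ^ 2 + 2 * (k : ℝ))) : ℝ) :
      ℂ) ^ 2 = Fintype.card (Pairing n) / (∏ k ∈ Finset.range n, (‖z‖ ^ 2 + 2 * (k : ℝ)) : ℝ) := by
    rw [← Complex.ofReal_pow, Real.sq_sqrt (by positivity), Complex.ofReal_div,
      Complex.ofReal_natCast]
  have hy : z ^ y.circles ≠ 0 := pow_ne_zero _ hz
  rw [Fz, Fz, weight, ← card_pairing, map_mul, Complex.conj_ofReal, map_pow, mul_mul_mul_comm,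
    ← sq, hsqrt, zpow_sub₀ hz, zpow_natCast, zpow_natCast, Complex.ofReal_div, ← hconj]
  field_simp

variable (hz : z ≠ 0)

theorem sphericalFun_eq_sum_weight (g : Perm (Letters n)) :
    sphericalFun hz (toS2inf n g) = ∑ x : Pairing n, (weight (‖z‖ ^ 2) x : ℂ) *
      z ^ (((g • x).circles : ℤ) - x.circles) := by
  rw [← integral_comp_p (sq_norm_pos hz) fun x : Pairing n =>
    z ^ (((g • x).circles : ℤ) - x.circles), sphericalFun, L2.inner_def]
  have hone : oneVec hz =ᵐ[ewens (sq_norm_pos hz)] fun _ => 1 := MemLp.coeFn_toLp _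
  have hrep : repT hz (MulOpposite.op (toS2inf n g)) (oneVec hz) =ᵐ[ewens (sq_norm_pos hz)]
      twist z (toS2inf n g) fun _ => 1 :=
    (coeFn_opT hz (toS2inf n g) (oneVec hz)).trans (twist_congr hz _ hone)
  refine integral_congr_ae ?_
  filter_upwards [hone, hrep] with x hx hx'
  have hs : Supported n (toS2inf n g : Perm ℤ) := supported_ofSubtype g
  rw [hx, hx', twist, cocycle_eq hs, XLim.p_smul hs, restr_toS2inf]
  simp

theorem sphericalFun_one (n : ℕ) : sphericalFun hz (toS2inf n 1) = 1 := by
  rw [sphericalFun_eq_sum_weight]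
  simp only [one_smul, sub_self, zpow_zero, mul_one]
  exact_mod_cast sum_weight (sq_norm_pos hz) n

theorem sphericalFun_eq_innerX (g : Perm (Letters n)) :
    sphericalFun hz (toS2inf n g) = innerX (fun x => Fz z n (g • x)) (Fz z n) := by
  have : Nonempty (Pairing n) := ⟨basePairing n⟩
  rw [sphericalFun_eq_sum_weight, innerX]
  simp only [Fz_mul_conj_Fz hz]
  rw [← Finset.mul_sum, inv_mul_cancel_left₀ (Nat.cast_ne_zero.2 Fintype.card_ne_zero)]

theorem sphericalFun_eq_sum_zonal (g : Perm (Letters n)) :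
    sphericalFun hz (toS2inf n g) = ∑ lam : Young n, (zMeasure z lam : ℂ) * zonal lam g := by
  have hF : ∀ h ∈ hyperoctahedral n, ∀ x, Fz z n (h • x) = Fz z n x := fun h hh x => by
    rw [Fz, circles_smul hh, Fz]
  rw [sphericalFun_eq_innerX, innerX_smul_self_eq_sum_zonal hF]
  rfl

end SphericalFunction

end GelfandZ

end

theorem mainTheorem2 {z : ℂ} (hz : z ≠ 0) (n : ℕ) :
    (∀ g : Equiv.Perm (GelfandZ.Letters n),
      GelfandZ.sphericalFun hz (GelfandZ.toS2inf n g) =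
        ∑ lam : GelfandZ.Young n, (GelfandZ.zMeasure z lam : ℂ) * GelfandZ.zonal lam g) ∧
    (∀ lam : GelfandZ.Young n, 0 ≤ GelfandZ.zMeasure z lam) ∧
    ∑ lam : GelfandZ.Young n, GelfandZ.zMeasure z lam = 1 := by
  refine ⟨GelfandZ.sphericalFun_eq_sum_zonal hz, fun lam => sq_nonneg _, ?_⟩
  have hsum := GelfandZ.sphericalFun_eq_sum_zonal hz (n := n) 1
  simp only [GelfandZ.sphericalFun_one, GelfandZ.zonal_one, mul_one] at hsum
  exact_mod_cast hsum.symm
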